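/- Let $G$ be a (finite-dimensional, real) local Lie group with unit $e$, Lie algebra $\mathfrak g=T_eG$, bracket $[\cdot,\cdot]$ and exponential map $\exp$. Let $H$ be a local closed (embedded) Lie subgroup of $G$ with Lie algebra $\mathfrak h$, and let $Q$ be a smooth submanifold through $e$, transversal to $H$, which is a section of the left cosets of $H$ near $e$; put $V=T_eQ$, so that $\mathfrak g=V\oplus\mathfrak h$, and let $\Pi:\mathfrak g\to V$ be the projection parallel to $\mathfrak h$. Near $0$ let $\varphi:V\to\mathfrak h$ be the map with $\varphi(0)=0$ and $\exp(\xi+\varphi(\xi))\in Q$, and let $R:V\times V\to\mathfrak h$ be the symmetric bilinear map with $\varphi(\xi)=R(\xi,\xi)+O(|\xi|^3)$. Use $x\in V$ as the coordinate of the point $\exp(x+\varphi(x))$ of $Q$. The projection of $G$ on $Q$ parallel to $H$ ($g=qh\mapsto q$) gives the local loop $x\times y=\Pi_Q(x\cdot y)$ on $Q$; write $\mu(x,y)\in V$ for it in coordinates. On $Q\times Q$ near $(e,e)$ consider the 3-web $x=\mathrm{const}$, $y=\mathrm{const}$, $\mu(x,y)=\mathrm{const}$, with the forms $\omega_1^i=\frac{\partial\mu^i}{\partial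 x^\alpha}dx^\alpha$, $\omega_2^i=\frac{\partial\mu^i}{\partial y^\beta}dy^\beta$, and its Chern connection $\omega^k_j=\Gamma^k_{ij}\omega_1^i+\Gamma^k_{jl}\omega_2^l$, where $\Gamma^k_{ij}=-\widetilde P^\alpha_i\widetilde Q^\beta_j\frac{\partial^2\mu^k}{\partial x^\alpha\partial y^\beta}$ and $\widetilde P,\widetilde Q$ are the inverses of the matrices $(\partial\mu^i/\partial x^\alpha)$, $(\partial\mu^i/\partial y^\beta)$. Its torsion tensor is $a^k_{ij}=\Gamma^k_{[ij]}$, and its curvature tensor $b$ is defined by $d\omega^k_j=\omega^i_j\wedge\omega^k_i+b^k_{jlm}\,\omega_1^l\wedge\omega_2^m$. Let $\overset{2}{\nabla}_m$ be the component along $\omega_2^m$ of the covariant derivative for this connection. Put $a(\xi,\eta)=a^i_{jk}\xi^j\eta^k$ and $b(\xi,\eta,\zeta)=b^i_{jkl}\xi^j\eta^k\zeta^l$ at $(e,e)$, and $$d(\xi,\eta,\zeta,\tau)=d^i_{jklm}\xi^j\eta^k\zeta^l\tau^m=\overset{2}{\nabla}_m b^i_{jkl}\Big|_{(e,e)}\xi^j\eta^k\zeta^l\tau^m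 .$$ For $u\in G$ near $e$ let $b''_u$ be the value at $(e,e)$ of the curvature tensor of the loop on $Q$ defined in the same way by the projection on $Q$ parallel to $uHu^{-1}$ in place of $H$. Then $\mu$ is smooth near $(0,0)$, and for all $\xi,\eta,\zeta,\tau\in V$ $$\begin{aligned} d(\xi,\eta,\zeta,\tau)&=\frac{d}{dt}\,b''_{\exp t\tau}(\xi,\eta,\zeta)\Big|_{t=0}\\ &=\tfrac12\Pi[\tau,[[\xi,\eta],\zeta]]-\tfrac12\Pi[\tau,\Pi[[\xi,\eta],\zeta]]-\tfrac12\Pi[\tau,[\Pi[\xi,\eta],\zeta]]+\tfrac12\Pi[\tau,\Pi[\Pi[\xi,\eta],\zeta]]\\ &\quad-\tfrac12\Pi[\Pi[\tau,[\xi,\eta]],\zeta]+\tfrac12\Pi[\Pi[\tau,\Pi[\xi,\eta]],\zeta]+2\Pi[\tau,[R(\xi,\eta),\zeta]]\\ &\quad-2\Pi[\tau,\Pi[R(\xi,\eta),\zeta]]-2\Pi[\Pi[\tau,R(\xi,\eta)],\zeta], \end{aligned}$$ the derivative on the right of the first equality being claimed to exist. Moreover $d^i_{jk[lm]}=-b^i_{jkp}a^p_{lm}$,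 that is, $$\tfrac12\big(d(\xi,\eta,\zeta,\tau)-d(\xi,\eta,\tau,\zeta)\big)=-b(\xi,\eta,a(\zeta,\tau)).$$ -/

import Mathlib

open scoped ContDiff Topology

noncomputable section

/-! ### Three-webs of a local product and the Chern connection

`f : W × W → W` is a smooth product near a point (in a coordinate space `W`). The web on `W × W`
has the leaves `x = const`, `y = const`, `f (x, y) = const`, and the basic forms
`ω₁ = P dx`, `ω₂ = Q dy` with `P = ∂f/∂x`, `Q = ∂f/∂y`. -/

section Web

variable {W : Type*} [NormedAddCommGroup W] [NormedSpace ℝ W]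

/-- `P = ∂f/∂x` at `p = (x, y)`. -/
def webP (f : W × W → W) (p : W × W) : W →L[ℝ] W := fderiv ℝ (fun x => f (x, p.2)) p.1

/-- `Q = ∂f/∂y` at `p = (x, y)`. -/
def webQ (f : W × W → W) (p : W × W) : W →L[ℝ] W := fderiv ℝ (fun y => f (p.1, y)) p.2

/-- The mixed second derivative `∂²f/∂x∂y`; the first argument is the `x`-direction. -/
def webMixed (f : W × W → W) (p : W × W) : W →L[ℝ] W →L[ℝ] W :=
  fderiv ℝ (fun x => webQ f (x, p.2)) p.1

/-- `Γ^k_{ij} ξ^i η^j = - (∂²f^k/∂x^α∂y^β) (P⁻¹ξ)^α (Q⁻¹η)^β`. -/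
def chernGamma (f : W × W → W) (p : W × W) (ξ η : W) : W :=
  -webMixed f p ((webP f p).inverse ξ) ((webQ f p).inverse η)

/-- The connection form `ω^k_j = Γ^k_{ij} ω₁^i + Γ^k_{jl} ω₂^l`, evaluated at the tangent vector
`X` at `p` and applied to `ζ`: this is `ω^k_j(X) ζ^j`. -/
def chernForm (f : W × W → W) (p X : W × W) (ζ : W) : W :=
  chernGamma f p (webP f p X.1) ζ + chernGamma f p ζ (webQ f p X.2)

/-- The curvature form `dω^k_j - ω^i_j ∧ ω^k_i`, evaluated at `(X, Y)` and applied to `ζ`. -/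
def chernCurv (f : W × W → W) (p X Y : W × W) (ζ : W) : W :=
  fderiv ℝ (fun p' => chernForm f p' Y ζ) p X - fderiv ℝ (fun p' => chernForm f p' X ζ) p Y
    + chernForm f p X (chernForm f p Y ζ) - chernForm f p Y (chernForm f p X ζ)

/-- The torsion tensor `a^k_{ij} ξ^i η^j = Γ^k_{[ij]} ξ^i η^j`. -/
def webA (f : W × W → W) (p : W × W) (ξ η : W) : W :=
  (1 / 2 : ℝ) • (chernGamma f p ξ η - chernGamma f p η ξ)

/-- The curvature tensor `b^k_{jlm} ξ^j η^l ζ^m`, where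
`dω^k_j = ω^i_j ∧ ω^k_i + b^k_{jlm} ω₁^l ∧ ω₂^m`. -/
def webB (f : W × W → W) (p : W × W) (ξ η ζ : W) : W :=
  chernCurv f p ((webP f p).inverse η, 0) (0, (webQ f p).inverse ζ) ξ

/-- `(∇²_m b^i_{jkl}) ξ^j η^k ζ^l τ^m`: the covariant derivative of the tensor field `b` for the
Chern connection, in the direction `Y` with `ω₁(Y) = 0` and `ω₂(Y) = τ`. -/
def webNablaTwoB (f : W × W → W) (p : W × W) (ξ η ζ τ : W) : W :=
  let Y : W × W := (0, (webQ f p).inverse τ)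
  fderiv ℝ (fun p' => webB f p' ξ η ζ) p Y + chernForm f p Y (webB f p ξ η ζ)
    - webB f p (chernForm f p Y ξ) η ζ - webB f p ξ (chernForm f p Y η) ζ
    - webB f p ξ η (chernForm f p Y ζ)

end Web

/-! ### Local Lie groups -/

/-- A local Lie group, in a chart with values in `E` that sends the unit to `0`. The operations
matter only near `0`; their values elsewhere are irrelevant. -/
structure LocalLieGroup (E : Type*) [NormedAddCommGroup E] [NormedSpace ℝ E] where
  mul : E → E → E
  inv : E → E
  smooth_mul : ∀ᶠ p in 𝓝 (0 : E × E), ContDiffAt ℝ ∞ (fun p : E × E => mul p.1 p.2) p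
  smooth_inv : ∀ᶠ x in 𝓝 (0 : E), ContDiffAt ℝ ∞ inv x
  one_mul : ∀ᶠ x in 𝓝 (0 : E), mul 0 x = x
  mul_one : ∀ᶠ x in 𝓝 (0 : E), mul x 0 = x
  mul_assoc : ∀ᶠ p in 𝓝 (0 : E × E × E),
    mul (mul p.1 p.2.1) p.2.2 = mul p.1 (mul p.2.1 p.2.2)
  inv_zero : inv 0 = 0
  inv_mul : ∀ᶠ x in 𝓝 (0 : E), mul (inv x) x = 0
  mul_inv : ∀ᶠ x in 𝓝 (0 : E), mul x (inv x) = 0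

section LocalGroup

variable {E : Type*} [NormedAddCommGroup E] [NormedSpace ℝ E]

/-- `S` is, near `0 ∈ S`, an embedded smooth submanifold with tangent space `W` at `0`: a slice
chart `Ψ`, normalized by `dΨ₀ = id`, carries `S` to `W`. -/
def IsSubmanifoldAtZero (S : Set E) (W : Submodule ℝ E) : Prop :=
  ∃ Ψ : E → E, (∀ᶠ x in 𝓝 (0 : E), ContDiffAt ℝ ∞ Ψ x) ∧ Ψ 0 = 0 ∧
    HasFDerivAt Ψ (ContinuousLinearMap.id ℝ E) 0 ∧ ∀ᶠ x in 𝓝 (0 : E), x ∈ S ↔ Ψ x ∈ W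

namespace LocalLieGroup

variable (G : LocalLieGroup E)

/-- The Lie bracket on the tangent space `E` at the unit: the antisymmetric part of the second
order term `β` of `x · y = x + y + β(x, y) + …`, that is `[X, Y] = β(X, Y) - β(Y, X)`. -/
def bracket (X Y : E) : E :=
  fderiv ℝ (fun x => fderiv ℝ (fun y => G.mul x y) 0 Y) 0 X
    - fderiv ℝ (fun x => fderiv ℝ (fun y => G.mul x y) 0 X) 0 Y

/-- `e` is the exponential map of `G` near `0`: it is smooth, and each `t ↦ e (t x)` is the
one-parameter subgroup with velocity `x`. -/
def IsExp (e : E → E) : Prop :=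
  (∀ᶠ x in 𝓝 (0 : E), ContDiffAt ℝ ∞ e x) ∧ e 0 = 0 ∧
    HasFDerivAt e (ContinuousLinearMap.id ℝ E) 0 ∧
    ∀ᶠ x in 𝓝 (0 : E), ∀ s ∈ Set.Icc (-1 : ℝ) 1, ∀ t ∈ Set.Icc (-1 : ℝ) 1,
      e ((s + t) • x) = G.mul (e (s • x)) (e (t • x))

/-- `H` is a local (closed, embedded) Lie subgroup of `G` with tangent space `h` at the unit. -/
def IsLocalSubgroup (H : Set E) (h : Submodule ℝ E) : Prop :=
  IsSubmanifoldAtZero H h ∧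
    (∀ᶠ p in 𝓝 (0 : E × E), p.1 ∈ H → p.2 ∈ H → G.mul p.1 p.2 ∈ H) ∧
    ∀ᶠ x in 𝓝 (0 : E), x ∈ H → G.inv x ∈ H

/-- The conjugate subgroup `u H u⁻¹`, described near the unit as `{x | u⁻¹ x u ∈ H}`. -/
def conjSubgroup (H : Set E) (u : E) : Set E := {x | G.mul (G.mul (G.inv u) x) u ∈ H}

end LocalLieGroup

/-! ### The section `Q` and its loop -/

/-- `φ : V → h` is the map with `exp (ξ + φ ξ) ∈ Q` and small values for small `ξ`; this
determines `φ` near `0`. -/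
def IsSectionMap (exp : E → E) (Q : Set E) (V h : Submodule ℝ E) (φ : V → h) : Prop :=
  φ 0 = 0 ∧ ContinuousAt φ 0 ∧ ∀ᶠ ξ : V in 𝓝 (0 : V), exp ((ξ : E) + (φ ξ : E)) ∈ Q

/-- The map `φ` (its germ at `0` is the one determined by `IsSectionMap`). -/
def sectionMap (exp : E → E) (Q : Set E) (V h : Submodule ℝ E) : V → h :=
  Classical.epsilon (IsSectionMap exp Q V h)

/-- The symmetric bilinear map `R : V × V → h` in `φ(ξ) = R(ξ, ξ) + S(ξ, ξ, ξ) + o(3)`. -/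
def sectionR (exp : E → E) (Q : Set E) (V h : Submodule ℝ E) (ξ η : V) : h :=
  (1 / 2 : ℝ) • fderiv ℝ (fderiv ℝ (sectionMap exp Q V h)) 0 ξ η

/-- The point of `Q` with coordinate `x ∈ V`: `exp (x + φ x)`. -/
def sectionPoint (exp : E → E) (Q : Set E) (V h : Submodule ℝ E) (x : V) : E :=
  exp ((x : E) + (sectionMap exp Q V h x : E))

/-- `π : G → V` gives the coordinate of the projection of `G` on a section `q : V → G` parallel to
the subgroup `K`: `g ∈ q(π g) K`, with small values for small `g`; this determines `π` near the
unit. -/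
def IsCosetProj (G : LocalLieGroup E) (K : Set E) {V : Submodule ℝ E} (q : V → E) (π : E → V) :
    Prop :=
  π 0 = 0 ∧ ContinuousAt π 0 ∧ ∀ᶠ g in 𝓝 (0 : E), G.mul (G.inv (q (π g))) g ∈ K

/-- The coordinate of the projection on the section `q` parallel to `K`. -/
def cosetProj (G : LocalLieGroup E) (K : Set E) {V : Submodule ℝ E} (q : V → E) : E → V :=
  Classical.epsilon (IsCosetProj G K q)

/-- The product on the section `q`, in coordinates: `(x, y)` goes to the coordinate of the
projection of `q x · q y` on the section parallel to `K`. -/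
def loopLaw (G : LocalLieGroup E) (K : Set E) {V : Submodule ℝ E} (q : V → E) (p : V × V) : V :=
  cosetProj G K q (G.mul (q p.1) (q p.2))

end LocalGroup

/-- The setting: a local Lie group `G` with exponential map `exp`, a local closed subgroup `H` with
tangent space `h`, and a smooth section `Q` of the left cosets `G mod H` through the unit, with
tangent space `V`, transversal to `H`. -/
structure LoopInGroup (E : Type*) [NormedAddCommGroup E] [NormedSpace ℝ E] where
  G : LocalLieGroup E
  exp : E → E
  isExp : G.IsExp exp
  H : Set E
  h : Submodule ℝ E
  isLocalSubgroup : G.IsLocalSubgroup H h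
  Q : Set E
  V : Submodule ℝ E
  isSubmanifold : IsSubmanifoldAtZero Q V
  isCompl : IsCompl V h

namespace LoopInGroup

variable {E : Type*} [NormedAddCommGroup E] [NormedSpace ℝ E] (S : LoopInGroup E)

/-- The Lie bracket of the Lie algebra of `G`. -/
def br (x y : E) : E := S.G.bracket x y

/-- The projection of the Lie algebra on `V` parallel to `h`. -/
def Pr (x : E) : E := S.V.projectionOnto S.h S.isCompl x

/-- The bilinear map `R` with `exp (ξ + R(ξ, ξ) + …) ∈ Q`. -/
def R (ξ η : S.V) : E := sectionR S.exp S.Q S.V S.h ξ η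

/-- The point of `Q` with coordinate `x`. -/
def point (x : S.V) : E := sectionPoint S.exp S.Q S.V S.h x

/-- The loop law of `Q`, in the coordinates of `V`. -/
def law : S.V × S.V → S.V := loopLaw S.G S.H S.point

/-- The loop law on `Q` given by the projection parallel to `u H u⁻¹`. -/
def lawConj (u : E) : S.V × S.V → S.V := loopLaw S.G (S.G.conjSubgroup S.H u) S.point

/-- The structure tensor `a` of the loop: the torsion tensor of its web at `(e, e)`. -/
def a (ξ η : S.V) : S.V := webA S.law 0 ξ η

/-- The structure tensor `b` of the loop: the curvature tensor of its web at `(e, e)`. -/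
def b (ξ η ζ : S.V) : S.V := webB S.law 0 ξ η ζ

/-- The structure tensor `d = ∇² b` at `(e, e)`. -/
def d (ξ η ζ τ : S.V) : S.V := webNablaTwoB S.law 0 ξ η ζ τ

/-- The structure tensor `b` of the loop on `Q` given by the projection parallel to `u H u⁻¹`. -/
def bConj (u : E) (ξ η ζ : S.V) : S.V := webB (S.lawConj u) 0 ξ η ζ

end LoopInGroup

end

/-! Near the unit, `G` acts on `Q ≃ G / H`, and the loop law is `(x, y) ↦ q(x) • y`, where `q(x)` is
the point of `Q` with coordinate `x`. Along `x = 0` the frame `∂μ/∂x` of the web is the frame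
`P_y ξ = L_y ξ` of fundamental vector fields of the action, and `∂μ/∂x` is parallel in the
directions `x = const`. Let `Λ_y = P_y⁻¹ L_y` be the projection of the Lie algebra on `V` parallel
to the isotropy algebra of `y`. In the frame `P_y` the curvature at `(0, y)` has the components
`C(Λ_y)`, where

  `C(Λ)(ξ, η, ζ) = -Λ[w - Λ w, ζ]`, `w = ½[ξ, η] + 2 R(ξ, η)`,

so `d` is the ordinary derivative of `C(Λ_y)` at `y = 0`. The isotropy algebra of `y` is the Lie
algebra of `q(y) H q(y)⁻¹`, hence `C(Λ_y)` is also the curvature at `(e, e)` of the loop of this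
conjugate, and `d` is the derivative of `b''` along the conjugates. The bracket formula follows from
`Λ'_τ v = Λ[v - Λ v, τ]`. In the frame `∂μ/∂x` the alternation of `d` is the commutator of two
derivatives along `x = const`, which commute up to the torsion. -/

open Filter

set_option maxSynthPendingDepth 3

noncomputable section

section Calculus

variable {E F V : Type*} [NormedAddCommGroup E] [NormedSpace ℝ E]
  [NormedAddCommGroup F] [NormedSpace ℝ F] [NormedAddCommGroup V] [NormedSpace ℝ V]

theorem contDiffAt_fderiv {f : E → F} {x : E} (hf : ContDiffAt ℝ ∞ f x) :
    ContDiffAt ℝ ∞ (fderiv ℝ f) x :=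
  hf.fderiv_right (by simp)

theorem fderiv_apply_const {T : E → F →L[ℝ] V} {x : E} (hT : DifferentiableAt ℝ T x) (v : F)
    (w : E) : fderiv ℝ (fun y => T y v) x w = fderiv ℝ T x w v := by
  simp [fderiv_clm_apply hT (differentiableAt_const v)]

theorem fderiv_fderiv_comm {f : E → F} {x : E} (hf : ContDiffAt ℝ ∞ f x) (v w : E) :
    fderiv ℝ (fderiv ℝ f) x v w = fderiv ℝ (fderiv ℝ f) x w v :=
  (hf.isSymmSndFDerivAt
    (by rw [minSmoothness_of_isRCLikeNormedField]; exact ENat.LEInfty.out)).eq v w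

theorem apply_self_eq_zero_of_hasFDerivAt {T : E → E →L[ℝ] F} {T' : E →L[ℝ] E →L[ℝ] F}
    (hT : HasFDerivAt T T' 0) (h0 : T 0 = 0) (hself : ∀ᶠ x in 𝓝 (0 : E), T x x = 0) (x : E) :
    T' x x = 0 := by
  have hTline : HasDerivAt (fun t : ℝ => T (t • x)) (T' x) 0 := by
    simpa only [HasLineDerivAt, zero_add] using hT.hasLineDerivAt x
  have hline : Tendsto (fun t : ℝ => t • x) (𝓝 0) (𝓝 0) :=
    (continuous_id.smul continuous_const).tendsto' _ _ (zero_smul ℝ x)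
  have hzero : (fun t : ℝ => T (t • x) x) =ᶠ[𝓝 0] fun _ => 0 := by
    filter_upwards [hline.eventually hself] with t ht
    rcases eq_or_ne t 0 with rfl | hne
    · simp [h0]
    · simpa [hne] using ht
  have happly : HasDerivAt (fun t : ℝ => T (t • x) x) (T' x x) 0 := by
    simpa using hTline.clm_apply (hasDerivAt_const (0 : ℝ) x)
  exact happly.unique ((hasDerivAt_const (0 : ℝ) (0 : F)).congr_of_eventuallyEq hzero)

theorem hasFDerivAt_comp_of_eq {g : F → V} {f : E → F} {g' : F →L[ℝ] V} {f' : E →L[ℝ] F} {x : E}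
    {y : F} (hg : HasFDerivAt g g' y) (hf : HasFDerivAt f f' x) (hy : f x = y) :
    HasFDerivAt (fun x => g (f x)) (g' ∘L f') x :=
  HasFDerivAt.comp x (hy ▸ hg) hf

theorem fderiv_prodMk_left {f : E × F → V} {p : E × F} (hf : DifferentiableAt ℝ f p) :
    fderiv ℝ (fun x => f (x, p.2)) p.1 = fderiv ℝ f p ∘L .inl ℝ E F :=
  (hf.hasFDerivAt.comp p.1 (hasFDerivAt_prodMk_left p.1 p.2)).fderiv

theorem fderiv_prodMk_right {f : E × F → V} {p : E × F} (hf : DifferentiableAt ℝ f p) :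
    fderiv ℝ (fun y => f (p.1, y)) p.2 = fderiv ℝ f p ∘L .inr ℝ E F :=
  (hf.hasFDerivAt.comp p.2 (hasFDerivAt_prodMk_right p.1 p.2)).fderiv

theorem eventually_differentiableAt {f : E → F} {x : E} (hf : ContDiffAt ℝ ∞ f x) :
    ∀ᶠ y in 𝓝 x, DifferentiableAt ℝ f y :=
  ((hf.of_le (m := 1) ENat.LEInfty.out).eventually (by simp)).mono
    fun _ h => h.differentiableAt (by simp)

theorem fderiv_fderiv_comp {g : F → V} {f : E → F} {x : E} (hg : ContDiffAt ℝ ∞ g (f x))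
    (hf : ContDiffAt ℝ ∞ f x) (v w : E) :
    fderiv ℝ (fderiv ℝ (fun y => g (f y))) x v w =
      fderiv ℝ (fderiv ℝ g) (f x) (fderiv ℝ f x v) (fderiv ℝ f x w)
        + fderiv ℝ g (f x) (fderiv ℝ (fderiv ℝ f) x v w) := by
  have hchain : fderiv ℝ (fun y => g (f y)) =ᶠ[𝓝 x] fun y => fderiv ℝ g (f y) ∘L fderiv ℝ f y := by
    filter_upwards [hf.continuousAt.eventually (eventually_differentiableAt hg),
      eventually_differentiableAt hf] with y hgy hfy using fderiv_comp y hgy hfy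
  have hDg : HasFDerivAt (fun y => fderiv ℝ g (f y)) _ x :=
    ((contDiffAt_fderiv hg).differentiableAt (by simp)).hasFDerivAt.comp x
      (hf.differentiableAt (by simp)).hasFDerivAt
  have hDf := ((contDiffAt_fderiv hf).differentiableAt (by simp)).hasFDerivAt
  rw [hchain.fderiv_eq, (hDg.clm_comp hDf).fderiv]
  simp [add_comm]

theorem eventually_isInvertible [CompleteSpace F] {X : Type*} [TopologicalSpace X]
    {T : X → F →L[ℝ] V} {x : X} (hT : ContinuousAt T x) (hx : (T x).IsInvertible) :
    ∀ᶠ y in 𝓝 x, (T y).IsInvertible := by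
  obtain ⟨e, he⟩ := hx
  exact hT (he ▸ e.nhds)

theorem contDiffAt_inverse [CompleteSpace F] {T : E → F →L[ℝ] V} {x : E}
    (hT : ContDiffAt ℝ ∞ T x) (hx : (T x).IsInvertible) :
    ContDiffAt ℝ ∞ (fun y => (T y).inverse) x :=
  hx.contDiffAt_map_inverse.comp x hT

theorem contDiffAt_flip {X : Type*} [NormedAddCommGroup X] [NormedSpace ℝ X]
    {B : X → E →L[ℝ] F →L[ℝ] V} {x : X} (hB : ContDiffAt ℝ ∞ B x) :
    ContDiffAt ℝ ∞ (fun y => (B y).flip) x :=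
  (ContinuousLinearMap.flipₗᵢ ℝ E F V).toContinuousLinearEquiv.contDiff.contDiffAt.comp x hB

theorem contDiffAt_bilinearComp {E' F' : Type*} [NormedAddCommGroup E'] [NormedSpace ℝ E']
    [NormedAddCommGroup F'] [NormedSpace ℝ F'] {X : Type*} [NormedAddCommGroup X] [NormedSpace ℝ X]
    {B : X → E →L[ℝ] F →L[ℝ] V} {S : X → E' →L[ℝ] E} {T : X → F' →L[ℝ] F} {x : X}
    (hB : ContDiffAt ℝ ∞ B x) (hS : ContDiffAt ℝ ∞ S x) (hT : ContDiffAt ℝ ∞ T x) :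
    ContDiffAt ℝ ∞ (fun y => (B y).bilinearComp (S y) (T y)) x :=
  contDiffAt_flip ((contDiffAt_flip (hB.clm_comp hS)).clm_comp hT)

end Calculus

section SmoothGerm

variable {E F V : Type*} [NormedAddCommGroup E] [NormedSpace ℝ E]
  [NormedAddCommGroup F] [NormedSpace ℝ F] [NormedAddCommGroup V] [NormedSpace ℝ V]

/-- `f` represents the germ at `0` of a smooth map that sends `0` to `0`. Smoothness is required
on a neighbourhood, since `ContDiffAt ℝ ∞ f 0` alone does not provide it. -/
structure IsSmoothGerm (f : E → F) : Prop where
  smooth : ∀ᶠ x in 𝓝 (0 : E), ContDiffAt ℝ ∞ f x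
  map_zero : f 0 = 0

namespace IsSmoothGerm

variable {f : E → F} {g : F → V}

theorem contDiffAt (hf : IsSmoothGerm f) : ContDiffAt ℝ ∞ f 0 := hf.smooth.self_of_nhds

theorem tendsto (hf : IsSmoothGerm f) : Tendsto f (𝓝 0) (𝓝 0) := by
  simpa only [hf.map_zero] using hf.contDiffAt.continuousAt.tendsto

theorem hasFDerivAt (hf : IsSmoothGerm f) : HasFDerivAt f (fderiv ℝ f 0) 0 :=
  (hf.contDiffAt.differentiableAt (by simp)).hasFDerivAt

theorem of_clm (L : E →L[ℝ] F) : IsSmoothGerm L :=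
  ⟨.of_forall fun _ => L.contDiff.contDiffAt, L.map_zero⟩

theorem congr {f' : E → F} (hf : IsSmoothGerm f) (h : f' =ᶠ[𝓝 0] f) : IsSmoothGerm f' where
  smooth := by
    filter_upwards [hf.smooth, h.eventuallyEq_nhds] with x hx hx' using
      hx.congr_of_eventuallyEq hx'
  map_zero := h.self_of_nhds.trans hf.map_zero

theorem comp (hg : IsSmoothGerm g) (hf : IsSmoothGerm f) : IsSmoothGerm fun x => g (f x) where
  smooth := by
    filter_upwards [hf.tendsto.eventually hg.smooth, hf.smooth] with x hgx hfx using hgx.comp x hfx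
  map_zero := by rw [hf.map_zero, hg.map_zero]

theorem prodMk {f' : E → V} (hf : IsSmoothGerm f) (hf' : IsSmoothGerm f') :
    IsSmoothGerm fun x => (f x, f' x) where
  smooth := by filter_upwards [hf.smooth, hf'.smooth] with x hx hx' using hx.prodMk hx'
  map_zero := by rw [hf.map_zero, hf'.map_zero]; rfl

theorem contDiffAt_comp (hg : ContDiffAt ℝ ∞ g 0) (hf : IsSmoothGerm f) :
    ContDiffAt ℝ ∞ (fun x => g (f x)) 0 :=
  ContDiffAt.comp 0 (hf.map_zero ▸ hg) hf.contDiffAt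

/-- Mathlib's implicit function is only known to be smooth at the base point; near it, it agrees
with the implicit functions based at neighbouring points of the graph. -/
theorem exists_implicit [CompleteSpace E] [CompleteSpace F] [CompleteSpace V]
    {Φ : E × F → V} {Φ' : E × F →L[ℝ] V}
    (hΦ : IsSmoothGerm Φ) (hΦ' : HasFDerivAt Φ Φ' 0) (hinv : (Φ' ∘L .inr ℝ E F).IsInvertible) :
    ∃ φ : E → F, IsSmoothGerm φ ∧
      HasFDerivAt φ (-(Φ' ∘L .inr ℝ E F).inverse ∘L (Φ' ∘L .inl ℝ E F)) 0 ∧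
      ∀ᶠ z in 𝓝 (0 : E × F), Φ z = 0 ↔ φ z.1 = z.2 := by
  have hn : (∞ : WithTop ℕ∞) ≠ 0 := by simp
  have hinv' : (fderiv ℝ Φ 0 ∘L .inr ℝ E F).IsInvertible := hΦ'.fderiv ▸ hinv
  have hzero := hΦ.contDiffAt.eventually_apply_eq_iff_implicitFunction hn hinv'
  have hgraph := hΦ.contDiffAt.eventually_apply_implicitFunction hn hinv'
  have hderiv := (hΦ.contDiffAt.hasStrictFDerivAt_implicitFunction hn hinv').hasFDerivAt
  have hsmooth := hΦ.contDiffAt.contDiffAt_implicitFunction hn hinv'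
  have hφ0 : hΦ.contDiffAt.implicitFunction hn hinv' 0 = 0 :=
    hΦ.contDiffAt.implicitFunction_apply_self hn hinv'
  set φ := hΦ.contDiffAt.implicitFunction hn hinv'
  rw [hΦ'.fderiv] at hderiv
  rw [hΦ.map_zero] at hzero hgraph
  refine ⟨φ, ⟨?_, hφ0⟩, hderiv, hzero⟩
  have hpoint : Tendsto (fun x => (x, φ x)) (𝓝 0) (𝓝 0) := by
    have h : Tendsto φ (𝓝 0) (𝓝 0) := hφ0 ▸ hsmooth.continuousAt.tendsto
    exact tendsto_id.prodMk_nhds h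
  have hinv_near : ∀ᶠ z in 𝓝 (0 : E × F), (fderiv ℝ Φ z ∘L .inr ℝ E F).IsInvertible :=
    eventually_isInvertible
      ((contDiffAt_fderiv hΦ.contDiffAt).continuousAt.clm_comp continuousAt_const) hinv'
  filter_upwards [eventually_differentiableAt hsmooth, hpoint.eventually hΦ.smooth,
    hpoint.eventually hinv_near, hgraph.eventually_nhds] with x hφx hΦx hinvx hgraphx
  have hagree : φ =ᶠ[𝓝 x] hΦx.implicitFunction hn hinvx := by
    have hlocal := (continuousAt_id.prodMk hφx.continuousAt).eventually
      (hΦx.eventually_apply_eq_iff_implicitFunction hn hinvx)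
    filter_upwards [hlocal, hgraphx] with y hy hΦy
    exact (hy.1 (hΦy.trans hgraphx.self_of_nhds.symm)).symm
  exact (hΦx.contDiffAt_implicitFunction hn hinvx).congr_of_eventuallyEq hagree

end IsSmoothGerm

end SmoothGerm

section Web

variable {W : Type*} [NormedAddCommGroup W] [NormedSpace ℝ W] {f : W × W → W} {p : W × W}

theorem webP_eventuallyEq (hf : ContDiffAt ℝ ∞ f p) :
    webP f =ᶠ[𝓝 p] fun p' => fderiv ℝ f p' ∘L .inl ℝ W W :=
  (eventually_differentiableAt hf).mono fun _ h => fderiv_prodMk_left h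

theorem webQ_eventuallyEq (hf : ContDiffAt ℝ ∞ f p) :
    webQ f =ᶠ[𝓝 p] fun p' => fderiv ℝ f p' ∘L .inr ℝ W W :=
  (eventually_differentiableAt hf).mono fun _ h => fderiv_prodMk_right h

theorem contDiffAt_webP (hf : ContDiffAt ℝ ∞ f p) : ContDiffAt ℝ ∞ (webP f) p :=
  ((contDiffAt_fderiv hf).clm_comp contDiffAt_const).congr_of_eventuallyEq (webP_eventuallyEq hf)

theorem contDiffAt_webQ (hf : ContDiffAt ℝ ∞ f p) : ContDiffAt ℝ ∞ (webQ f) p :=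
  ((contDiffAt_fderiv hf).clm_comp contDiffAt_const).congr_of_eventuallyEq (webQ_eventuallyEq hf)

theorem webMixed_eq (hf : ContDiffAt ℝ ∞ f p) :
    webMixed f p = fderiv ℝ (webQ f) p ∘L .inl ℝ W W :=
  fderiv_prodMk_left ((contDiffAt_webQ hf).differentiableAt (by simp))

theorem contDiffAt_webMixed (hf : ContDiffAt ℝ ∞ f p) : ContDiffAt ℝ ∞ (webMixed f) p :=
  ((contDiffAt_fderiv (contDiffAt_webQ hf)).clm_comp contDiffAt_const).congr_of_eventuallyEq <|
    (eventually_differentiableAt (contDiffAt_webQ hf)).mono fun _ h => fderiv_prodMk_left h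

theorem fderiv_webP_snd (hf : ContDiffAt ℝ ∞ f p) (ξ η : W) :
    fderiv ℝ (webP f) p (0, η) ξ = webMixed f p ξ η := by
  have hD : HasFDerivAt (fderiv ℝ f) (fderiv ℝ (fderiv ℝ f) p) p :=
    ((contDiffAt_fderiv hf).differentiableAt (by simp)).hasFDerivAt
  rw [webMixed_eq hf, (webP_eventuallyEq hf).fderiv_eq, (webQ_eventuallyEq hf).fderiv_eq,
    (hD.clm_comp (hasFDerivAt_const _ p)).fderiv, (hD.clm_comp (hasFDerivAt_const _ p)).fderiv]
  simpa using fderiv_fderiv_comm hf (0, η) (ξ, 0)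

theorem fderiv_webQ_snd_comm (hf : ContDiffAt ℝ ∞ f p) (η ζ : W) :
    fderiv ℝ (webQ f) p (0, η) ζ = fderiv ℝ (webQ f) p (0, ζ) η := by
  have hD : HasFDerivAt (fderiv ℝ f) (fderiv ℝ (fderiv ℝ f) p) p :=
    ((contDiffAt_fderiv hf).differentiableAt (by simp)).hasFDerivAt
  rw [(webQ_eventuallyEq hf).fderiv_eq, (hD.clm_comp (hasFDerivAt_const _ p)).fderiv]
  simpa using fderiv_fderiv_comm hf (0, η) (0, ζ)

/-- The web of `f` is smooth and in general position near `p`. -/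
structure IsRegularWebAt (f : W × W → W) (p : W × W) : Prop where
  smooth : ∀ᶠ p' in 𝓝 p, ContDiffAt ℝ ∞ f p'
  isInvertible_webP : (webP f p).IsInvertible
  isInvertible_webQ : (webQ f p).IsInvertible

/-- The connection form as a continuous bilinear map, for use under derivatives. -/
def chernFormL (f : W × W → W) (p : W × W) : W × W →L[ℝ] W →L[ℝ] W :=
  -((webMixed f p).bilinearComp (.fst ℝ W W) (webQ f p).inverse
    + (webMixed f p).flip.bilinearComp (.snd ℝ W W) (webP f p).inverse)

/-- The covariant derivative at `p`, along `X`, of the vector field whose `ω₁`-components are `s`,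
for the Chern connection. -/
def webCov (f : W × W → W) (s : W × W → W) (p X : W × W) : W :=
  fderiv ℝ s p X + chernForm f p X (s p)

/-- The components of `∇_{(η, 0)} s`, where `s = P ξ`, in the frame formed by the columns of
`P = ∂f/∂x`. -/
def frameForm (f : W × W → W) (p : W × W) (ξ η : W) : W :=
  (webP f p).inverse (webCov f (fun p' => webP f p' ξ) p (η, 0))

theorem webCov_congr {s t : W × W → W} (h : s =ᶠ[𝓝 p] t) (X : W × W) :
    webCov f s p X = webCov f t p X := by
  rw [webCov, webCov, h.fderiv_eq, h.self_of_nhds]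

namespace IsRegularWebAt

theorem contDiffAt (hf : IsRegularWebAt f p) : ContDiffAt ℝ ∞ f p := hf.smooth.self_of_nhds

theorem eventually [CompleteSpace W] (hf : IsRegularWebAt f p) :
    ∀ᶠ p' in 𝓝 p, IsRegularWebAt f p' := by
  filter_upwards [hf.smooth.eventually_nhds,
    eventually_isInvertible (contDiffAt_webP hf.contDiffAt).continuousAt hf.isInvertible_webP,
    eventually_isInvertible (contDiffAt_webQ hf.contDiffAt).continuousAt hf.isInvertible_webQ]
    with p' h hP hQ using ⟨h, hP, hQ⟩

theorem chernForm_eq (hf : IsRegularWebAt f p) (X : W × W) (ζ : W) :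
    chernForm f p X ζ = chernFormL f p X ζ := by
  obtain ⟨eP, hP⟩ := hf.isInvertible_webP
  obtain ⟨eQ, hQ⟩ := hf.isInvertible_webQ
  simp [chernForm, chernGamma, chernFormL, ← hP, ← hQ]
  abel

theorem webCov_eq (hf : IsRegularWebAt f p) {s : W × W → W} {s' : W × W →L[ℝ] W}
    (hs : HasFDerivAt s s' p) (X : W × W) :
    webCov f s p X = s' X + chernFormL f p X (s p) := by
  rw [webCov, hs.fderiv, hf.chernForm_eq]

theorem webCov_webP (hf : IsRegularWebAt f p) {v : W × W → W} (hv : DifferentiableAt ℝ v p)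
    (ζ : W) :
    webCov f (fun p' => webP f p' (v p')) p (0, ζ) = webP f p (fderiv ℝ v p (0, ζ)) := by
  obtain ⟨eP, hP⟩ := hf.isInvertible_webP
  have hDP := ((contDiffAt_webP hf.contDiffAt).differentiableAt (by simp)).hasFDerivAt
  rw [hf.webCov_eq (hDP.clm_apply hv.hasFDerivAt)]
  simp [chernFormL, ← hP, fderiv_webP_snd hf.contDiffAt]

theorem webCov_webP_const (hf : IsRegularWebAt f p) (ξ ζ : W) :
    webCov f (fun p' => webP f p' ξ) p (0, ζ) = 0 := by
  simpa using hf.webCov_webP (differentiableAt_const ξ) ζ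

theorem frameForm_eq (hf : IsRegularWebAt f p) (ξ η : W) :
    frameForm f p ξ η = (webP f p).inverse
      (fderiv ℝ (webP f) p (η, 0) ξ - webMixed f p η ((webQ f p).inverse (webP f p ξ))) := by
  have hDP := ((contDiffAt_webP hf.contDiffAt).differentiableAt (by simp)).hasFDerivAt
  rw [frameForm, hf.webCov_eq (hDP.clm_apply (hasFDerivAt_const ξ p))]
  simp [chernFormL, sub_eq_add_neg]

variable [CompleteSpace W]

theorem contDiffAt_chernFormL (hf : IsRegularWebAt f p) : ContDiffAt ℝ ∞ (chernFormL f) p :=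
  ((contDiffAt_bilinearComp (contDiffAt_webMixed hf.contDiffAt) contDiffAt_const
      (contDiffAt_inverse (contDiffAt_webQ hf.contDiffAt) hf.isInvertible_webQ)).add
    (contDiffAt_bilinearComp (contDiffAt_flip (contDiffAt_webMixed hf.contDiffAt)) contDiffAt_const
      (contDiffAt_inverse (contDiffAt_webP hf.contDiffAt) hf.isInvertible_webP))).neg

theorem hasFDerivAt_chernForm (hf : IsRegularWebAt f p) (X : W × W) {s : W × W → W}
    {s' : W × W →L[ℝ] W} (hs : HasFDerivAt s s' p) :
    HasFDerivAt (fun p' => chernForm f p' X (s p'))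
      ((chernFormL f p X) ∘L s' + ((fderiv ℝ (chernFormL f) p).flip X).flip (s p)) p := by
  have hΩ := (hf.contDiffAt_chernFormL.differentiableAt (by simp)).hasFDerivAt
  refine ((hΩ.clm_apply (hasFDerivAt_const X p)).clm_apply hs).congr_of_eventuallyEq
    (hf.eventually.mono fun p' h => h.chernForm_eq X (s p')) |>.congr_fderiv ?_
  ext Y <;> simp

theorem chernCurv_eq (hf : IsRegularWebAt f p) (X Y : W × W) (ζ : W) :
    chernCurv f p X Y ζ =
      fderiv ℝ (chernFormL f) p X Y ζ - fderiv ℝ (chernFormL f) p Y X ζ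
        + chernFormL f p X (chernFormL f p Y ζ) - chernFormL f p Y (chernFormL f p X ζ) := by
  simp only [chernCurv, (hf.hasFDerivAt_chernForm _ (hasFDerivAt_const ζ p)).fderiv,
    hf.chernForm_eq]
  simp

theorem chernCurv_eq_commutator (hf : IsRegularWebAt f p) {s : W × W → W}
    (hs : ContDiffAt ℝ ∞ s p) (X Y : W × W) :
    chernCurv f p X Y (s p) =
      webCov f (fun p' => webCov f s p' Y) p X - webCov f (fun p' => webCov f s p' X) p Y := by
  have hcov (Z : W × W) : HasFDerivAt (fun p' => webCov f s p' Z) _ p :=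
    (((contDiffAt_fderiv hs).differentiableAt (by simp)).hasFDerivAt.clm_apply
      (hasFDerivAt_const Z p)).add
      (hf.hasFDerivAt_chernForm Z (hs.differentiableAt (by simp)).hasFDerivAt)
  rw [hf.webCov_eq (hcov Y), hf.webCov_eq (hcov X), hf.chernCurv_eq]
  simp [webCov, hf.chernForm_eq, fderiv_fderiv_comm hs X Y]
  abel

/-- The curvature tensor is a smooth field of trilinear maps; the arguments of `T` come in the
order in which `webB` feeds them to the curvature form. -/
theorem exists_webB_eq (hf : IsRegularWebAt f p) :
    ∃ T : W × W → W →L[ℝ] W →L[ℝ] W →L[ℝ] W, ContDiffAt ℝ ∞ T p ∧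
      ∀ᶠ p' in 𝓝 p, ∀ ξ η ζ, webB f p' ξ η ζ = T p' η ζ ξ := by
  let comm (p' : W × W) :=
    (ContinuousLinearMap.compL ℝ W W W).bilinearComp (chernFormL f p') (chernFormL f p')
  let K (p' : W × W) : W × W →L[ℝ] W × W →L[ℝ] W →L[ℝ] W :=
    fderiv ℝ (chernFormL f) p' - (fderiv ℝ (chernFormL f) p').flip + comm p' - (comm p').flip
  have hΩ := hf.contDiffAt_chernFormL
  have hDΩ := contDiffAt_fderiv hΩ
  have hcomm : ContDiffAt ℝ ∞ comm p := contDiffAt_bilinearComp contDiffAt_const hΩ hΩ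
  have hK : ContDiffAt ℝ ∞ K p :=
    ((hDΩ.sub (contDiffAt_flip hDΩ)).add hcomm).sub (contDiffAt_flip hcomm)
  refine ⟨fun p' => (K p').bilinearComp (.inl ℝ W W ∘L (webP f p').inverse)
    (.inr ℝ W W ∘L (webQ f p').inverse), contDiffAt_bilinearComp hK
      (contDiffAt_const.clm_comp
        (contDiffAt_inverse (contDiffAt_webP hf.contDiffAt) hf.isInvertible_webP))
      (contDiffAt_const.clm_comp
        (contDiffAt_inverse (contDiffAt_webQ hf.contDiffAt) hf.isInvertible_webQ)), ?_⟩
  filter_upwards [hf.eventually] with p' h ξ η ζ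
  simp [webB, h.chernCurv_eq, K, comm]

theorem webNablaTwoB_of_parallel (hf : IsRegularWebAt f p) {s₁ s₂ s₃ : W × W → W} {τ : W}
    (hs₁ : DifferentiableAt ℝ s₁ p) (hs₂ : DifferentiableAt ℝ s₂ p)
    (hs₃ : DifferentiableAt ℝ s₃ p) (h₁ : webCov f s₁ p (0, (webQ f p).inverse τ) = 0)
    (h₂ : webCov f s₂ p (0, (webQ f p).inverse τ) = 0)
    (h₃ : webCov f s₃ p (0, (webQ f p).inverse τ) = 0) :
    webNablaTwoB f p (s₁ p) (s₂ p) (s₃ p) τ =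
      webCov f (fun p' => webB f p' (s₁ p') (s₂ p') (s₃ p')) p (0, (webQ f p).inverse τ) := by
  obtain ⟨T, hT, hTB⟩ := hf.exists_webB_eq
  replace hT := (hT.differentiableAt (by simp)).hasFDerivAt
  have hconst : HasFDerivAt (fun p' => webB f p' (s₁ p) (s₂ p) (s₃ p)) _ p :=
    (((hT.clm_apply (hasFDerivAt_const (s₂ p) p)).clm_apply
      (hasFDerivAt_const (s₃ p) p)).clm_apply (hasFDerivAt_const (s₁ p) p)).congr_of_eventuallyEq
      (hTB.mono fun p' h => h _ _ _)
  have hfields : HasFDerivAt (fun p' => webB f p' (s₁ p') (s₂ p') (s₃ p')) _ p :=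
    (((hT.clm_apply hs₂.hasFDerivAt).clm_apply hs₃.hasFDerivAt).clm_apply
      hs₁.hasFDerivAt).congr_of_eventuallyEq (hTB.mono fun p' h => h _ _ _)
  rw [webNablaTwoB, webCov, hconst.fderiv, hfields.fderiv]
  simp only [webCov] at h₁ h₂ h₃
  simp only [hTB.self_of_nhds, eq_neg_of_add_eq_zero_right h₁, eq_neg_of_add_eq_zero_right h₂,
    eq_neg_of_add_eq_zero_right h₃]
  simp
  abel

theorem contDiffAt_frameForm (hf : IsRegularWebAt f p) (ξ η : W) :
    ContDiffAt ℝ ∞ (fun p' => frameForm f p' ξ η) p := by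
  have hP := contDiffAt_webP hf.contDiffAt
  refine ContDiffAt.congr_of_eventuallyEq ?_ (hf.eventually.mono fun p' h => h.frameForm_eq ξ η)
  exact (contDiffAt_inverse hP hf.isInvertible_webP).clm_apply <|
    (((contDiffAt_fderiv hP).clm_apply contDiffAt_const).clm_apply contDiffAt_const).sub <|
      ((contDiffAt_webMixed hf.contDiffAt).clm_apply contDiffAt_const).clm_apply <|
        (contDiffAt_inverse (contDiffAt_webQ hf.contDiffAt) hf.isInvertible_webQ).clm_apply
          (hP.clm_apply contDiffAt_const)

theorem webB_webP (hf : IsRegularWebAt f p) (ξ η ζ : W) :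
    webB f p (webP f p ξ) (webP f p η) ζ =
      -webP f p (fderiv ℝ (fun p' => frameForm f p' ξ η) p (0, (webQ f p).inverse ζ)) := by
  have hparallel : (fun p' => webCov f (fun p'' => webP f p'' ξ) p' (0, (webQ f p).inverse ζ))
      =ᶠ[𝓝 p] 0 := hf.eventually.mono fun p' h => h.webCov_webP_const ξ _
  have hframe : (fun p' => webCov f (fun p'' => webP f p'' ξ) p' (η, 0))
      =ᶠ[𝓝 p] fun p' => webP f p' (frameForm f p' ξ η) := by
    filter_upwards [hf.eventually] with p' h
    rw [frameForm, h.isInvertible_webP.self_apply_inverse]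
  rw [webB, hf.isInvertible_webP.inverse_apply_self, hf.chernCurv_eq_commutator
      ((contDiffAt_webP hf.contDiffAt).clm_apply contDiffAt_const), webCov_congr hparallel,
    webCov_congr hframe,
    hf.webCov_webP ((hf.contDiffAt_frameForm ξ η).differentiableAt (by simp))]
  simp [webCov, hf.chernForm_eq]

theorem differentiableAt_inverse_webB (hf : IsRegularWebAt f p) (ξ η ζ : W) :
    DifferentiableAt ℝ (fun p' => (webP f p').inverse
      (webB f p' (webP f p' ξ) (webP f p' η) (webP f p' ζ))) p := by
  have hP := contDiffAt_webP hf.contDiffAt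
  have hfield (ξ : W) : ContDiffAt ℝ ∞ (fun p' => webP f p' ξ) p := hP.clm_apply contDiffAt_const
  obtain ⟨T, hT, hTB⟩ := hf.exists_webB_eq
  have hsmooth := (contDiffAt_inverse hP hf.isInvertible_webP).clm_apply
    (((hT.clm_apply (hfield η)).clm_apply (hfield ζ)).clm_apply (hfield ξ))
  refine (hsmooth.differentiableAt (by simp)).congr_of_eventuallyEq ?_
  filter_upwards [hTB] with p' h using by rw [h]

theorem webNablaTwoB_webP (hf : IsRegularWebAt f p) (ξ η ζ τ : W) :
    webNablaTwoB f p (webP f p ξ) (webP f p η) (webP f p ζ) τ =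
      webP f p (fderiv ℝ (fun p' => (webP f p').inverse
        (webB f p' (webP f p' ξ) (webP f p' η) (webP f p' ζ))) p (0, (webQ f p).inverse τ)) := by
  have hdiff (ξ : W) : DifferentiableAt ℝ (fun p' => webP f p' ξ) p :=
    ((contDiffAt_webP hf.contDiffAt).clm_apply contDiffAt_const).differentiableAt (by simp)
  rw [hf.webNablaTwoB_of_parallel (hdiff ξ) (hdiff η) (hdiff ζ) (hf.webCov_webP_const ξ _)
    (hf.webCov_webP_const η _) (hf.webCov_webP_const ζ _),
    ← hf.webCov_webP (hf.differentiableAt_inverse_webB ξ η ζ)]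
  refine webCov_congr ?_ _
  filter_upwards [hf.eventually] with p' h
  rw [h.isInvertible_webP.self_apply_inverse]

theorem webQ_fderiv_inverse_webP (hf : IsRegularWebAt f p) (ζ η : W) :
    webQ f p (fderiv ℝ (fun p' => (webQ f p').inverse (webP f p' ζ)) p (0, η)) =
      webMixed f p ζ η - fderiv ℝ (webQ f) p (0, η) ((webQ f p).inverse (webP f p ζ)) := by
  have hP := contDiffAt_webP hf.contDiffAt
  have hQ := contDiffAt_webQ hf.contDiffAt
  have hv : ContDiffAt ℝ ∞ (fun p' => (webQ f p').inverse (webP f p' ζ)) p :=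
    (contDiffAt_inverse hQ hf.isInvertible_webQ).clm_apply (hP.clm_apply contDiffAt_const)
  have hcancel : (fun p' => webQ f p' ((webQ f p').inverse (webP f p' ζ)))
      =ᶠ[𝓝 p] fun p' => webP f p' ζ := by
    filter_upwards [hf.eventually] with p' h using h.isInvertible_webQ.self_apply_inverse _
  have hleibniz := ((hQ.differentiableAt (by simp)).hasFDerivAt.clm_apply
    (hv.differentiableAt (by simp)).hasFDerivAt).fderiv
  have h := DFunLike.congr_fun hleibniz (0, η)
  rw [hcancel.fderiv_eq, fderiv_apply_const (hP.differentiableAt (by simp)),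
    fderiv_webP_snd hf.contDiffAt] at h
  rw [h]
  simp

theorem webNablaTwoB_eq_frameForm (hf : IsRegularWebAt f p) (ξ η ζ τ : W) :
    webNablaTwoB f p (webP f p ξ) (webP f p η) (webP f p ζ) τ =
      -webP f p (fderiv ℝ (fderiv ℝ (fun p' => frameForm f p' ξ η)) p (0, (webQ f p).inverse τ)
          (0, (webQ f p).inverse (webP f p ζ))
        + fderiv ℝ (fun p' => frameForm f p' ξ η) p (0, fderiv ℝ
          (fun p' => (webQ f p').inverse (webP f p' ζ)) p (0, (webQ f p).inverse τ))) := by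
  set A : W × W → W := fun p' => frameForm f p' ξ η with hA
  set v : W × W → W := fun p' => (webQ f p').inverse (webP f p' ζ) with hv
  have hAsmooth : ContDiffAt ℝ ∞ A p := hf.contDiffAt_frameForm ξ η
  have hvsmooth : ContDiffAt ℝ ∞ v p :=
    (contDiffAt_inverse (contDiffAt_webQ hf.contDiffAt) hf.isInvertible_webQ).clm_apply
      ((contDiffAt_webP hf.contDiffAt).clm_apply contDiffAt_const)
  have hcomponents : (fun p' => (webP f p').inverse
      (webB f p' (webP f p' ξ) (webP f p' η) (webP f p' ζ)))
      =ᶠ[𝓝 p] fun p' => -fderiv ℝ A p' (0, v p') := by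
    filter_upwards [hf.eventually] with p' h
    rw [h.webB_webP, map_neg, h.isInvertible_webP.inverse_apply_self]
  have hderiv : HasFDerivAt (fun p' => -fderiv ℝ A p' (0, v p')) _ p :=
    (((contDiffAt_fderiv hAsmooth).differentiableAt (by simp)).hasFDerivAt.clm_apply
    ((hasFDerivAt_const (0 : W) p).prodMk (hvsmooth.differentiableAt (by simp)).hasFDerivAt)).neg
  rw [hf.webNablaTwoB_webP, hcomponents.fderiv_eq, hderiv.fderiv]
  simp [add_comm, hA, hv]

/-- Two derivatives of `frameForm` along the leaf `x = const` commute; what is left over comes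
from the torsion of the frame. -/
theorem webNablaTwoB_alternation (hf : IsRegularWebAt f p) (ξ η ζ τ : W) :
    (1 / 2 : ℝ) • (webNablaTwoB f p ξ η ζ τ - webNablaTwoB f p ξ η τ ζ) =
      -webB f p ξ η (webA f p ζ τ) := by
  obtain ⟨ξ, rfl⟩ := hf.isInvertible_webP.surjective ξ
  obtain ⟨η, rfl⟩ := hf.isInvertible_webP.surjective η
  obtain ⟨ζ, rfl⟩ := hf.isInvertible_webP.surjective ζ
  obtain ⟨τ, rfl⟩ := hf.isInvertible_webP.surjective τ
  set v : W → W × W → W := fun ζ p' => (webQ f p').inverse (webP f p' ζ)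
  have htorsion : (webQ f p).inverse (webA f p (webP f p ζ) (webP f p τ)) =
      -(1 / 2 : ℝ) • (fderiv ℝ (v ζ) p (0, v τ p) - fderiv ℝ (v τ) p (0, v ζ p)) := by
    apply hf.isInvertible_webQ.injective
    rw [hf.isInvertible_webQ.self_apply_inverse, map_smul, map_sub, hf.webQ_fderiv_inverse_webP,
      hf.webQ_fderiv_inverse_webP, fderiv_webQ_snd_comm hf.contDiffAt (v τ p), webA, chernGamma,
      chernGamma, hf.isInvertible_webP.inverse_apply_self, hf.isInvertible_webP.inverse_apply_self]
    module
  rw [hf.webNablaTwoB_eq_frameForm, hf.webNablaTwoB_eq_frameForm, hf.webB_webP, htorsion,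
    fderiv_fderiv_comm (hf.contDiffAt_frameForm ξ η) (0, v τ p) (0, v ζ p)]
  have hlinear (a b : W) :
      ((0, -(1 / 2 : ℝ) • (a - b)) : W × W) = -(1 / 2 : ℝ) • ((0, a) - (0, b)) := by simp
  rw [hlinear, map_smul, map_sub, map_smul, map_sub, map_add, map_add]
  module

end IsRegularWebAt

end Web

section Action

variable {E W : Type*} [NormedAddCommGroup E] [NormedSpace ℝ E] [NormedAddCommGroup W]
  [NormedSpace ℝ W]

namespace LocalLieGroup

variable (G : LocalLieGroup E)

theorem mul_zero_zero : G.mul 0 0 = 0 := G.one_mul.self_of_nhds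

theorem isSmoothGerm_mul : IsSmoothGerm fun p : E × E => G.mul p.1 p.2 :=
  ⟨G.smooth_mul, G.mul_zero_zero⟩

/-- The derivative at the unit of the left translation by `g`. -/
def leftDeriv (g : E) : E →L[ℝ] E := fderiv ℝ (G.mul g) 0

/-- The second order term `β` of the product `x · y = x + y + β(x, y) + …`. -/
def mulSnd : E →L[ℝ] E →L[ℝ] E := fderiv ℝ G.leftDeriv 0

/-- The Lie bracket as a continuous bilinear map. -/
def bracketL : E →L[ℝ] E →L[ℝ] E := G.mulSnd - G.mulSnd.flip

theorem eventually_hasFDerivAt_mul_left :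
    ∀ᶠ g in 𝓝 (0 : E), HasFDerivAt (G.mul g) (G.leftDeriv g) 0 := by
  filter_upwards [(IsSmoothGerm.of_clm (.inl ℝ E E)).tendsto.eventually G.smooth_mul] with g hg
  have hmul : HasFDerivAt (G.mul g) _ (0 : E) :=
    (hg.differentiableAt (by simp)).hasFDerivAt.comp (0 : E) (hasFDerivAt_prodMk_right g (0 : E))
  exact hmul.differentiableAt.hasFDerivAt

theorem leftDeriv_zero : G.leftDeriv 0 = .id ℝ E := by
  have h : G.mul 0 =ᶠ[𝓝 0] id := G.one_mul
  exact h.fderiv_eq.trans fderiv_id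

theorem contDiffAt_leftDeriv : ContDiffAt ℝ ∞ G.leftDeriv 0 := by
  have hslice : ContDiffAt ℝ ∞ (fun g => webQ (fun p : E × E => G.mul p.1 p.2) (g, (0 : E))) 0 :=
    (IsSmoothGerm.of_clm (.inl ℝ E E)).contDiffAt_comp
      (contDiffAt_webQ G.isSmoothGerm_mul.contDiffAt)
  exact hslice

theorem hasFDerivAt_leftDeriv : HasFDerivAt G.leftDeriv G.mulSnd 0 :=
  (G.contDiffAt_leftDeriv.differentiableAt (by simp)).hasFDerivAt

theorem bracketL_apply (X Y : E) : G.bracketL X Y = G.bracket X Y :=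
  have h := G.hasFDerivAt_leftDeriv.differentiableAt
  congr_arg₂ (· - ·) (fderiv_apply_const h Y X).symm (fderiv_apply_const h X Y).symm

theorem bracketL_swap (X Y : E) : G.bracketL X Y = -G.bracketL Y X := by
  simp [bracketL]

/-- A smooth left action of `G`, given near the unit and near the point `0` of `W`. -/
structure IsLocalAction (ρ : E × W → W) : Prop where
  smooth : ∀ᶠ p in 𝓝 (0 : E × W), ContDiffAt ℝ ∞ ρ p
  zero_act : ∀ᶠ y in 𝓝 (0 : W), ρ (0, y) = y
  mul_act : ∀ᶠ p in 𝓝 (0 : E × E × W), ρ (G.mul p.1 p.2.1, p.2.2) = ρ (p.1, ρ (p.2.1, p.2.2))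

end LocalLieGroup

/-- `actField ρ y X` is the value at `y` of the fundamental vector field of `X`, that is, the
derivative of `g ↦ ρ (g, y)` at the unit in the direction `X`. -/
def actField (ρ : E × W → W) (y : W) : E →L[ℝ] W := fderiv ℝ ρ (0, y) ∘L .inl ℝ E W

/-- The projection of the Lie algebra on `W` along the isotropy algebra `ker (actField ρ y)`,
when `actField ρ y ∘ ι` is invertible. -/
def actProj (ρ : E × W → W) (ι : W →L[ℝ] E) (y : W) : E →L[ℝ] W :=
  (actField ρ y ∘L ι).inverse ∘L actField ρ y

/-- `q` is a smooth map with derivative `ι` at `0` which, to first order, is a section of the orbit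
map `g ↦ ρ (g, 0)`. -/
structure IsActSection (ρ : E × W → W) (q : W → E) (ι : W →L[ℝ] E) : Prop where
  isSmoothGerm : IsSmoothGerm q
  hasFDerivAt : HasFDerivAt q ι 0
  actField_comp : actField ρ 0 ∘L ι = .id ℝ W

/-- The loop law `x × y = ρ (q x, y)`. -/
def actLaw (ρ : E × W → W) (q : W → E) (p : W × W) : W := ρ (q p.1, p.2)

/-- The second derivative at `0` of `q`, corrected by the second order term of the product. -/
def sectionSnd (G : LocalLieGroup E) (q : W → E) (ι : W →L[ℝ] E) : W →L[ℝ] W →L[ℝ] E :=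
  fderiv ℝ (fderiv ℝ q) 0 - (G.mulSnd.bilinearComp ι ι).flip

/-- The curvature, in the frame `∂f/∂x`, of the loop whose isotropy algebra is the kernel of the
projection `Λ`. -/
def projCurv (G : LocalLieGroup E) (q : W → E) (ι : W →L[ℝ] E) (Λ : E →L[ℝ] W) (ξ η ζ : W) : W :=
  -Λ (G.bracketL (sectionSnd G q ι ξ η - ι (Λ (sectionSnd G q ι ξ η))) (ι ζ))

theorem hasFDerivAt_projCurv (G : LocalLieGroup E) (q : W → E) (ι : W →L[ℝ] E) {X : Type*}
    [NormedAddCommGroup X] [NormedSpace ℝ X] {Λ : X → E →L[ℝ] W} {Λ' : X →L[ℝ] E →L[ℝ] W} {x : X}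
    (hΛ : HasFDerivAt Λ Λ' x) (ξ η ζ : W) :
    ∃ C' : X →L[ℝ] W, HasFDerivAt (fun x => projCurv G q ι (Λ x) ξ η ζ) C' x ∧ ∀ τ, C' τ =
      Λ x (G.bracketL (ι (Λ' τ (sectionSnd G q ι ξ η))) (ι ζ))
        - Λ' τ (G.bracketL (sectionSnd G q ι ξ η - ι (Λ x (sectionSnd G q ι ξ η))) (ι ζ)) := by
  have hw := (ι.hasFDerivAt.comp x (hΛ.clm_apply (hasFDerivAt_const (sectionSnd G q ι ξ η) x)))
  have hvert := hw.const_sub (sectionSnd G q ι ξ η)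
  have hbr := ((G.bracketL.flip (ι ζ)).hasFDerivAt).comp x hvert
  refine ⟨_, (hΛ.clm_apply hbr).neg, fun τ => ?_⟩
  simp
  abel

namespace LocalLieGroup.IsLocalAction

variable {G : LocalLieGroup E} {ρ : E × W → W} {q : W → E} {ι : W →L[ℝ] E}

theorem isSmoothGerm (hρ : G.IsLocalAction ρ) : IsSmoothGerm ρ :=
  ⟨hρ.smooth, hρ.zero_act.self_of_nhds⟩

theorem smooth_zero (hρ : G.IsLocalAction ρ) : ∀ᶠ y in 𝓝 (0 : W), ContDiffAt ℝ ∞ ρ (0, y) :=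
  (IsSmoothGerm.of_clm (.inr ℝ E W)).tendsto.eventually hρ.smooth

theorem fderiv_comp_leftDeriv (hρ : G.IsLocalAction ρ) :
    ∀ᶠ p in 𝓝 (0 : E × W),
      fderiv ℝ ρ p ∘L .inl ℝ E W ∘L G.leftDeriv p.1 =
        fderiv ℝ ρ p ∘L .inr ℝ E W ∘L actField ρ p.2 := by
  have hslice : Tendsto (fun p : E × W => (p.1, (0 : E), p.2)) (𝓝 0) (𝓝 0) :=
    (by fun_prop : Continuous fun p : E × W => (p.1, (0 : E), p.2)).tendsto' _ _ rfl
  have hfst := continuous_fst.tendsto' (0 : E × W) 0 rfl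
  have hsnd := continuous_snd.tendsto' (0 : E × W) 0 rfl
  filter_upwards [hslice.eventually hρ.mul_act.eventually_nhds, hρ.smooth,
    hfst.eventually (G.mul_one.and G.eventually_hasFDerivAt_mul_left),
    hsnd.eventually (hρ.zero_act.and hρ.smooth_zero)]
  rintro ⟨g, y⟩ hact hρgy ⟨hone, hDmul⟩ ⟨hzero, hy⟩
  dsimp only at hact hone hDmul hzero hy ⊢
  have hfiber : (fun h => ρ (G.mul g h, y)) =ᶠ[𝓝 0] fun h => ρ (g, ρ (h, y)) :=
    ((by fun_prop : Continuous fun h : E => (g, h, y)).tendsto' 0 _ rfl).eventually hact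
  have hDρ : HasFDerivAt ρ (fderiv ℝ ρ (g, y)) (g, y) :=
    (hρgy.differentiableAt (by simp)).hasFDerivAt
  have hDact : HasFDerivAt (fun h => ρ (h, y)) (actField ρ y) 0 :=
    (hy.differentiableAt (by simp)).hasFDerivAt.comp (0 : E) (hasFDerivAt_prodMk_left 0 y)
  have hleft : HasFDerivAt (fun h => ρ (G.mul g h, y)) _ 0 :=
    HasFDerivAt.comp (f := fun h => (G.mul g h, y)) (0 : E) (by rwa [hone])
      (hDmul.prodMk (hasFDerivAt_const y 0))
  have hright : HasFDerivAt (fun h => ρ (g, ρ (h, y))) _ 0 :=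
    HasFDerivAt.comp (f := fun h => (g, ρ (h, y))) (0 : E) (by rwa [hzero])
      ((hasFDerivAt_const g 0).prodMk hDact)
  have h := hfiber.fderiv_eq (𝕜 := ℝ)
  rw [hleft.fderiv, hright.fderiv] at h
  simpa [ContinuousLinearMap.ext_iff] using h

theorem contDiffAt_actField {y : W} (hy : ContDiffAt ℝ ∞ ρ (0, y)) :
    ContDiffAt ℝ ∞ (actField ρ) y :=
  (ContDiffAt.comp y (contDiffAt_fderiv hy) (contDiffAt_const.prodMk contDiffAt_id)).clm_comp
    contDiffAt_const

theorem fderiv_actField_apply {y : W} (hy : ContDiffAt ℝ ∞ ρ (0, y)) (w : W) (u : E) :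
    fderiv ℝ (actField ρ) y w u = fderiv ℝ (fderiv ℝ ρ) (0, y) (0, w) (u, 0) := by
  have hslice : HasFDerivAt (fun y => fderiv ℝ ρ (0, y)) _ y :=
    ((contDiffAt_fderiv hy).differentiableAt (by simp)).hasFDerivAt.comp y
      (hasFDerivAt_prodMk_right 0 y)
  have h : HasFDerivAt (actField ρ) _ y :=
    hslice.clm_comp (hasFDerivAt_const (ContinuousLinearMap.inl ℝ E W) y)
  rw [h.fderiv]
  simp

theorem fderiv_actField_actField (hρ : G.IsLocalAction ρ) :
    ∀ᶠ y in 𝓝 (0 : W), ∀ u v, fderiv ℝ (actField ρ) y (actField ρ y v) u =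
      fderiv ℝ (fderiv ℝ ρ) (0, y) (u, 0) (v, 0) + actField ρ y (G.mulSnd u v) := by
  have hslice := (IsSmoothGerm.of_clm (.inr ℝ E W)).tendsto
  filter_upwards [hρ.smooth_zero, hslice.eventually hρ.fderiv_comp_leftDeriv.eventually_nhds]
    with y hy hmul u v
  have hfiber : (fun g => fderiv ℝ ρ (g, y) (G.leftDeriv g v, 0)) =ᶠ[𝓝 0]
      fun g => fderiv ℝ ρ (g, y) (0, actField ρ y v) :=
    (((by fun_prop : Continuous fun g : E => (g, y)).tendsto' 0 _ rfl).eventually hmul).mono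
      fun g h => DFunLike.congr_fun h v
  have hDDρ : HasFDerivAt (fun g => fderiv ℝ ρ (g, y)) _ 0 :=
    ((contDiffAt_fderiv hy).differentiableAt (by simp)).hasFDerivAt.comp (0 : E)
      (hasFDerivAt_prodMk_left 0 y)
  have hleft := hDDρ.clm_apply ((G.hasFDerivAt_leftDeriv.clm_apply (hasFDerivAt_const v 0)).prodMk
    (hasFDerivAt_const (0 : W) 0))
  have hright := hDDρ.clm_apply (hasFDerivAt_const ((0 : E), actField ρ y v) 0)
  have h := DFunLike.congr_fun (hfiber.fderiv_eq (𝕜 := ℝ)) u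
  rw [hleft.fderiv, hright.fderiv] at h
  rw [fderiv_actField_apply hy, fderiv_fderiv_comm hy]
  simpa [G.leftDeriv_zero, actField, add_comm] using h.symm

theorem fderiv_actField_sub (hρ : G.IsLocalAction ρ) :
    ∀ᶠ y in 𝓝 (0 : W), ∀ u v, fderiv ℝ (actField ρ) y (actField ρ y v) u
      - fderiv ℝ (actField ρ) y (actField ρ y u) v = actField ρ y (G.bracketL u v) := by
  filter_upwards [hρ.smooth_zero, hρ.fderiv_actField_actField] with y hy h u v
  rw [h, h, fderiv_fderiv_comm hy (u, 0)]
  simp [LocalLieGroup.bracketL]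

theorem isSmoothGerm_actLaw (hρ : G.IsLocalAction ρ) (hq : IsSmoothGerm q) :
    IsSmoothGerm (actLaw ρ q) :=
  hρ.isSmoothGerm.comp <|
    (hq.comp (.of_clm (.fst ℝ W W))).prodMk (.of_clm (.snd ℝ W W))

theorem webP_actLaw_eventuallyEq (hρ : G.IsLocalAction ρ) (hq : IsSmoothGerm q) :
    webP (actLaw ρ q) =ᶠ[𝓝 0] fun p =>
      fderiv ℝ ρ (q p.1, p.2) ∘L .inl ℝ E W ∘L fderiv ℝ q p.1 := by
  have hfst := continuous_fst.tendsto' (0 : W × W) 0 rfl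
  have hsnd := continuous_snd.tendsto' (0 : W × W) 0 rfl
  have hpoint : Tendsto (fun p : W × W => (q p.1, p.2)) (𝓝 0) (𝓝 0) :=
    (hq.tendsto.comp hfst).prodMk_nhds hsnd
  filter_upwards [hfst.eventually hq.smooth, hpoint.eventually hρ.smooth] with p hqp hρp
  have hslice : HasFDerivAt (fun x => actLaw ρ q (x, p.2)) _ p.1 :=
    HasFDerivAt.comp (f := fun x => (q x, p.2)) p.1 (hρp.differentiableAt (by simp)).hasFDerivAt
      ((hqp.differentiableAt (by simp)).hasFDerivAt.prodMk (hasFDerivAt_const p.2 p.1))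
  rw [webP, hslice.fderiv]
  ext ξ
  simp

theorem webQ_actLaw (hρ : G.IsLocalAction ρ) (hq0 : q 0 = 0) :
    ∀ᶠ y in 𝓝 (0 : W), webQ (actLaw ρ q) (0, y) = .id ℝ W := by
  filter_upwards [hρ.zero_act.eventually_nhds] with y hy
  have hid : (fun y' => actLaw ρ q (0, y')) =ᶠ[𝓝 y] id := by
    simpa [actLaw, hq0, Filter.EventuallyEq] using hy
  exact hid.fderiv_eq.trans fderiv_id

variable (hρ : G.IsLocalAction ρ) (hq : IsActSection ρ q ι)
include hρ hq

theorem webP_actLaw : ∀ᶠ y in 𝓝 (0 : W), webP (actLaw ρ q) (0, y) = actField ρ y ∘L ι := by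
  filter_upwards [(IsSmoothGerm.of_clm (.inr ℝ W W)).tendsto.eventually
    (hρ.webP_actLaw_eventuallyEq hq.isSmoothGerm)] with y hy
  simpa [hq.hasFDerivAt.fderiv, hq.isSmoothGerm.map_zero, actField,
    ContinuousLinearMap.comp_assoc] using hy

theorem webP_actLaw_zero : webP (actLaw ρ q) 0 = .id ℝ W :=
  (hρ.webP_actLaw hq).self_of_nhds.trans hq.actField_comp

theorem webQ_actLaw_zero : webQ (actLaw ρ q) 0 = .id ℝ W :=
  (hρ.webQ_actLaw hq.isSmoothGerm.map_zero).self_of_nhds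

theorem isRegularWebAt_actLaw : IsRegularWebAt (actLaw ρ q) 0 where
  smooth := (hρ.isSmoothGerm_actLaw hq.isSmoothGerm).smooth
  isInvertible_webP := ⟨.refl ℝ W, (hρ.webP_actLaw_zero hq).symm⟩
  isInvertible_webQ := ⟨.refl ℝ W, (hρ.webQ_actLaw_zero hq).symm⟩

theorem fderiv_webP_actLaw :
    ∀ᶠ y in 𝓝 (0 : W), ∀ η w ξ, fderiv ℝ (webP (actLaw ρ q)) (0, y) (η, w) ξ =
      fderiv ℝ (fderiv ℝ ρ) (0, y) (ι η, w) (ι ξ, 0)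
        + actField ρ y (fderiv ℝ (fderiv ℝ q) 0 η ξ) := by
  filter_upwards [hρ.smooth_zero, (IsSmoothGerm.of_clm (.inr ℝ W W)).tendsto.eventually
    (hρ.webP_actLaw_eventuallyEq hq.isSmoothGerm).eventuallyEq_nhds] with y hy hP η w ξ
  have hq0 := hq.isSmoothGerm.map_zero
  have hpoint : HasFDerivAt (fun p : W × W => (q p.1, p.2)) _ (0, y) :=
    (HasFDerivAt.comp (f := Prod.fst) (0, y) hq.hasFDerivAt hasFDerivAt_fst).prodMk hasFDerivAt_snd
  have hDρ : HasFDerivAt (fun p : W × W => fderiv ℝ ρ (q p.1, p.2)) _ (0, y) :=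
    HasFDerivAt.comp (f := fun p : W × W => (q p.1, p.2)) (0, y)
      (by simpa [hq0] using ((contDiffAt_fderiv hy).differentiableAt (by simp)).hasFDerivAt) hpoint
  have hDq : HasFDerivAt (fun p : W × W => fderiv ℝ q p.1) _ (0, y) :=
    HasFDerivAt.comp (f := Prod.fst) (0, y)
      ((contDiffAt_fderiv hq.isSmoothGerm.contDiffAt).differentiableAt (by simp)).hasFDerivAt
      hasFDerivAt_fst
  have hinl := hasFDerivAt_const (𝕜 := ℝ) (ContinuousLinearMap.inl ℝ E W) ((0, y) : W × W)
  have hprod : HasFDerivAt (fun p : W × W =>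
      fderiv ℝ ρ (q p.1, p.2) ∘L .inl ℝ E W ∘L fderiv ℝ q p.1) _ (0, y) :=
    hDρ.clm_comp (hinl.clm_comp hDq)
  replace hP : webP (actLaw ρ q) =ᶠ[𝓝 (0, y)] _ := hP
  rw [hP.fderiv_eq, hprod.fderiv]
  simp [hq0, hq.hasFDerivAt.fderiv, actField, add_comm]

variable [CompleteSpace W]

theorem eventually_isRegularWebAt_actLaw :
    ∀ᶠ y in 𝓝 (0 : W), IsRegularWebAt (actLaw ρ q) (0, y) :=
  (IsSmoothGerm.of_clm (.inr ℝ W W)).tendsto.eventually (hρ.isRegularWebAt_actLaw hq).eventually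

theorem eventually_isInvertible_actField :
    ∀ᶠ y in 𝓝 (0 : W), (actField ρ y ∘L ι).IsInvertible := by
  filter_upwards [hρ.eventually_isRegularWebAt_actLaw hq, hρ.webP_actLaw hq] with y hy hP
    using hP ▸ hy.isInvertible_webP

theorem frameForm_actLaw :
    ∀ᶠ y in 𝓝 (0 : W), ∀ ξ η, frameForm (actLaw ρ q) (0, y) ξ η =
      actProj ρ ι y (sectionSnd G q ι ξ η) := by
  filter_upwards [hρ.eventually_isRegularWebAt_actLaw hq, hρ.webP_actLaw hq,
    hρ.webQ_actLaw hq.isSmoothGerm.map_zero, hρ.fderiv_webP_actLaw hq, hρ.smooth_zero,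
    hρ.fderiv_actField_actField] with y hreg hP hQ hDP hρy hfield ξ η
  have hmixed : webMixed (actLaw ρ q) (0, y) η (actField ρ y (ι ξ)) =
      fderiv ℝ (fderiv ℝ ρ) (0, y) (ι η, 0) (ι ξ, 0)
        + actField ρ y (G.mulSnd (ι η) (ι ξ)) := by
    rw [← hfield, fderiv_actField_apply hρy, ← fderiv_webP_snd hreg.contDiffAt, hDP]
    simp
  rw [hreg.frameForm_eq, hP, hQ, hDP]
  simp [hmixed, actProj, sectionSnd, fderiv_fderiv_comm hq.isSmoothGerm.contDiffAt η]

theorem contDiffAt_actProj : ∀ᶠ y in 𝓝 (0 : W), ContDiffAt ℝ ∞ (actProj ρ ι) y := by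
  filter_upwards [hρ.smooth_zero, hρ.eventually_isInvertible_actField hq] with y hy hinv
  have hfield := contDiffAt_actField hy
  exact (contDiffAt_inverse (hfield.clm_comp contDiffAt_const) hinv).clm_comp hfield

/-- The isotropy algebra moves with the point: with `Λ = actProj ρ ι y`, differentiate
`actField ρ y (ι (Λ v)) = actField ρ y v` along the field of `ι ζ`, and use that `v - ι (Λ v)` is in
the isotropy algebra. -/
theorem fderiv_actProj :
    ∀ᶠ y in 𝓝 (0 : W), ∀ ζ v, fderiv ℝ (actProj ρ ι) y (actField ρ y (ι ζ)) v =
      actProj ρ ι y (G.bracketL (v - ι (actProj ρ ι y v)) (ι ζ)) := by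
  filter_upwards [hρ.smooth_zero, (hρ.eventually_isInvertible_actField hq).eventually_nhds,
    hρ.contDiffAt_actProj hq, hρ.fderiv_actField_sub] with y hy hinv hproj hbracket ζ v
  have hDL := ((contDiffAt_actField hy).differentiableAt (by simp)).hasFDerivAt
  have hDproj := (hproj.differentiableAt (by simp)).hasFDerivAt
  have hcancel : (fun y' => actField ρ y' (ι (actProj ρ ι y' v))) =ᶠ[𝓝 y]
      fun y' => actField ρ y' v :=
    hinv.mono fun y' h => h.self_apply_inverse (actField ρ y' v)
  have hleft : HasFDerivAt (fun y' => actField ρ y' (ι (actProj ρ ι y' v))) _ y :=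
    hDL.clm_apply (ι.hasFDerivAt.comp y (hDproj.clm_apply (hasFDerivAt_const v y)))
  have hright := hDL.clm_apply (hasFDerivAt_const v y)
  have hvertical : actField ρ y (v - ι (actProj ρ ι y v)) = 0 := by
    rw [map_sub, sub_eq_zero]
    exact hcancel.self_of_nhds.symm
  have hderiv := DFunLike.congr_fun (hcancel.fderiv_eq (𝕜 := ℝ)) (actField ρ y (ι ζ))
  rw [hleft.fderiv, hright.fderiv] at hderiv
  apply hinv.self_of_nhds.injective
  calc actField ρ y (ι (fderiv ℝ (actProj ρ ι) y (actField ρ y (ι ζ)) v))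
      = fderiv ℝ (actField ρ) y (actField ρ y (ι ζ)) (v - ι (actProj ρ ι y v)) := by
        rw [map_sub, eq_sub_iff_add_eq]
        simpa using hderiv
    _ = actField ρ y (G.bracketL (v - ι (actProj ρ ι y v)) (ι ζ)) := by
        rw [← hbracket, hvertical, map_zero, zero_apply, sub_zero]
    _ = actField ρ y (ι (actProj ρ ι y (G.bracketL (v - ι (actProj ρ ι y v)) (ι ζ)))) :=
        (hinv.self_of_nhds.self_apply_inverse _).symm

theorem webB_actLaw :
    ∀ᶠ y in 𝓝 (0 : W), ∀ ξ η ζ, (webP (actLaw ρ q) (0, y)).inverse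
        (webB (actLaw ρ q) (0, y) (webP (actLaw ρ q) (0, y) ξ) (webP (actLaw ρ q) (0, y) η)
          (webP (actLaw ρ q) (0, y) ζ)) =
      projCurv G q ι (actProj ρ ι y) ξ η ζ := by
  filter_upwards [hρ.eventually_isRegularWebAt_actLaw hq, hρ.webP_actLaw hq,
    hρ.webQ_actLaw hq.isSmoothGerm.map_zero, (hρ.frameForm_actLaw hq).eventually_nhds,
    hρ.contDiffAt_actProj hq, hρ.fderiv_actProj hq] with y hreg hP hQ hframe hproj hDproj ξ η ζ
  have hslice := fderiv_prodMk_right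
    ((hreg.contDiffAt_frameForm ξ η).differentiableAt (by simp))
  have hframe' : (fun y' => frameForm (actLaw ρ q) (0, y') ξ η) =ᶠ[𝓝 y]
      fun y' => actProj ρ ι y' (sectionSnd G q ι ξ η) := hframe.mono fun y' h => h ξ η
  have hDframe (τ : W) : fderiv ℝ (fun p => frameForm (actLaw ρ q) p ξ η) (0, y) (0, τ) =
      fderiv ℝ (actProj ρ ι) y τ (sectionSnd G q ι ξ η) := by
    rw [← fderiv_apply_const (hproj.differentiableAt (by simp)), ← hframe'.fderiv_eq]
    exact (DFunLike.congr_fun hslice τ).symm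
  rw [hreg.webB_webP, map_neg, hreg.isInvertible_webP.inverse_apply_self, hDframe, hQ,
    ContinuousLinearMap.inverse_id, ContinuousLinearMap.id_apply, hP,
    ContinuousLinearMap.comp_apply, hDproj, projCurv]

theorem webB_actLaw_zero (ξ η ζ : W) :
    webB (actLaw ρ q) 0 ξ η ζ = projCurv G q ι (actProj ρ ι 0) ξ η ζ := by
  have h := (hρ.webB_actLaw hq).self_of_nhds ξ η ζ
  rw [Prod.mk_zero_zero, hρ.webP_actLaw_zero hq] at h
  simpa using h

theorem webNablaTwoB_actLaw_zero (ξ η ζ τ : W) :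
    webNablaTwoB (actLaw ρ q) 0 ξ η ζ τ =
      fderiv ℝ (fun y => projCurv G q ι (actProj ρ ι y) ξ η ζ) 0 τ := by
  have hreg := hρ.isRegularWebAt_actLaw hq
  have h := hreg.webNablaTwoB_webP ξ η ζ τ
  have hslice := fderiv_prodMk_right (hreg.differentiableAt_inverse_webB ξ η ζ)
  have hcurv : (fun y => projCurv G q ι (actProj ρ ι y) ξ η ζ) =ᶠ[𝓝 0] _ :=
    (hρ.webB_actLaw hq).mono fun y h => (h ξ η ζ).symm
  rw [hρ.webP_actLaw_zero hq, hρ.webQ_actLaw_zero hq] at h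
  rw [hcurv.fderiv_eq]
  exact (by simpa using h : _ = _).trans (DFunLike.congr_fun hslice τ).symm

end LocalLieGroup.IsLocalAction

end Action

namespace LocalLieGroup

variable {E : Type*} [NormedAddCommGroup E] [NormedSpace ℝ E] (G : LocalLieGroup E)

section Germs

variable {α : Type*} {l : Filter α} {a b c : α → E}

theorem tendsto_mul (ha : Tendsto a l (𝓝 0)) (hb : Tendsto b l (𝓝 0)) :
    Tendsto (fun x => G.mul (a x) (b x)) l (𝓝 0) :=
  G.isSmoothGerm_mul.tendsto.comp (ha.prodMk_nhds hb)

theorem isSmoothGerm_inv : IsSmoothGerm G.inv := ⟨G.smooth_inv, G.inv_zero⟩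

theorem tendsto_inv (ha : Tendsto a l (𝓝 0)) : Tendsto (fun x => G.inv (a x)) l (𝓝 0) :=
  G.isSmoothGerm_inv.tendsto.comp ha

theorem eventually_mul_assoc (ha : Tendsto a l (𝓝 0)) (hb : Tendsto b l (𝓝 0))
    (hc : Tendsto c l (𝓝 0)) :
    ∀ᶠ x in l, G.mul (G.mul (a x) (b x)) (c x) = G.mul (a x) (G.mul (b x) (c x)) :=
  (ha.prodMk_nhds (hb.prodMk_nhds hc)).eventually G.mul_assoc

theorem eventually_mul_inv_cancel_left (ha : Tendsto a l (𝓝 0)) (hb : Tendsto b l (𝓝 0)) :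
    ∀ᶠ x in l, G.mul (a x) (G.mul (G.inv (a x)) (b x)) = b x := by
  filter_upwards [G.eventually_mul_assoc ha (G.tendsto_inv ha) hb, ha.eventually G.mul_inv,
    hb.eventually G.one_mul] with x hassoc hinv hone
  rw [← hassoc, hinv, hone]

end Germs

theorem hasFDerivAt_mul :
    HasFDerivAt (fun p : E × E => G.mul p.1 p.2) (.fst ℝ E E + .snd ℝ E E) 0 := by
  have hmul := G.isSmoothGerm_mul.hasFDerivAt
  have hinl : fderiv ℝ (fun p : E × E => G.mul p.1 p.2) 0 ∘L .inl ℝ E E = .id ℝ E :=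
    (fderiv_prodMk_left hmul.differentiableAt).symm.trans
      ((show (fun x => G.mul x 0) =ᶠ[𝓝 0] id from G.mul_one).fderiv_eq.trans fderiv_id)
  have hinr : fderiv ℝ (fun p : E × E => G.mul p.1 p.2) 0 ∘L .inr ℝ E E = .id ℝ E :=
    (fderiv_prodMk_right hmul.differentiableAt).symm.trans G.leftDeriv_zero
  refine hmul.congr_fderiv (ContinuousLinearMap.prod_ext (hinl.trans ?_) (hinr.trans ?_)) <;>
    ext <;> simp

theorem hasFDerivAt_inv : HasFDerivAt G.inv (-.id ℝ E) 0 := by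
  have hinv := G.isSmoothGerm_inv.hasFDerivAt
  have hprod := hasFDerivAt_comp_of_eq G.hasFDerivAt_mul
    ((hasFDerivAt_id (0 : E)).prodMk hinv) (by simp [G.inv_zero])
  have hconst := hprod.unique ((hasFDerivAt_const (0 : E) (0 : E)).congr_of_eventuallyEq G.mul_inv)
  refine hinv.congr_fderiv (ContinuousLinearMap.ext fun v => ?_)
  have hv : v + fderiv ℝ G.inv 0 v = 0 := DFunLike.congr_fun hconst v
  exact eq_neg_of_add_eq_zero_right hv

namespace IsExp

variable {G} {e : E → E}

theorem isSmoothGerm (he : G.IsExp e) : IsSmoothGerm e := ⟨he.1, he.2.1⟩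

theorem hasFDerivAt (he : G.IsExp e) : HasFDerivAt e (.id ℝ E) 0 := he.2.2.1

theorem eventually_fderiv_self (he : G.IsExp e) :
    ∀ᶠ x in 𝓝 (0 : E), fderiv ℝ e x x = G.leftDeriv (e x) x := by
  filter_upwards [he.2.2.2, he.isSmoothGerm.smooth,
    he.isSmoothGerm.tendsto.eventually G.eventually_hasFDerivAt_mul_left] with x hhom hex hmul
  have hline : HasDerivAt (fun t : ℝ => e (x + t • x)) (fderiv ℝ e x x) 0 :=
    (hex.differentiableAt (by simp)).hasFDerivAt.hasLineDerivAt x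
  have hexp : HasDerivAt (fun t : ℝ => e (t • x)) x 0 := by
    simpa only [HasLineDerivAt, zero_add, ContinuousLinearMap.id_apply] using
      he.hasFDerivAt.hasLineDerivAt x
  have htranslate : HasDerivAt (fun t : ℝ => G.mul (e x) (e (t • x))) (G.leftDeriv (e x) x) 0 :=
    HasFDerivAt.comp_hasDerivAt (f := fun t : ℝ => e (t • x)) (0 : ℝ)
      (by simpa [he.isSmoothGerm.map_zero] using hmul) hexp
  have hparam : (fun t : ℝ => e (x + t • x)) =ᶠ[𝓝 0] fun t => G.mul (e x) (e (t • x)) := by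
    filter_upwards [Icc_mem_nhds (show (-1 : ℝ) < 0 by norm_num) one_pos] with t ht
    simpa only [add_smul, one_smul] using hhom 1 (by norm_num) t ht
  exact hline.unique (htranslate.congr_of_eventuallyEq hparam)

theorem fderiv_fderiv_zero (he : G.IsExp e) (x y : E) :
    fderiv ℝ (fderiv ℝ e) 0 x y = (1 / 2 : ℝ) • (G.mulSnd x y + G.mulSnd y x) := by
  have hDe := ((contDiffAt_fderiv he.isSmoothGerm.contDiffAt).differentiableAt
    (by simp)).hasFDerivAt
  have hdiff := hDe.sub (hasFDerivAt_comp_of_eq G.hasFDerivAt_leftDeriv he.hasFDerivAt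
    he.isSmoothGerm.map_zero)
  have hself : ∀ z, fderiv ℝ (fderiv ℝ e) 0 z z - G.mulSnd z z = 0 :=
    apply_self_eq_zero_of_hasFDerivAt hdiff
      (by simp [he.hasFDerivAt.fderiv, he.isSmoothGerm.map_zero, G.leftDeriv_zero])
      (he.eventually_fderiv_self.mono fun z hz => sub_eq_zero.2 hz)
  have hsym := fderiv_fderiv_comm he.isSmoothGerm.contDiffAt x y
  have hadd := hself (x + y)
  simp only [map_add, add_apply, ← hsym] at hadd
  linear_combination (norm := module) (1 / 2 : ℝ) • (hadd - hself x - hself y)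

end IsExp

end LocalLieGroup

section SectionMap

variable {E : Type*} [NormedAddCommGroup E] [NormedSpace ℝ E] {V h : Submodule ℝ E}

theorem projectionOntoL_comp_subtypeL (hc : V.IsTopCompl h) :
    V.projectionOntoL h hc ∘L V.subtypeL = .id ℝ V := by
  ext v
  simp

theorem projectionOntoL_comp_subtypeL_right (hc : V.IsTopCompl h) :
    V.projectionOntoL h hc ∘L h.subtypeL = 0 := by
  ext v
  simp

theorem IsSubmanifoldAtZero.exists_defining_map {Q : Set E} (hQ : IsSubmanifoldAtZero Q h)
    (hc : V.IsTopCompl h) : ∃ Θ : E → V, IsSmoothGerm Θ ∧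
      HasFDerivAt Θ (V.projectionOntoL h hc) 0 ∧ ∀ᶠ x in 𝓝 (0 : E), x ∈ Q ↔ Θ x = 0 := by
  obtain ⟨Ψ, hsmooth, hzero, hderiv, hmem⟩ := hQ
  have hΨ : IsSmoothGerm Ψ := ⟨hsmooth, hzero⟩
  exact ⟨fun x => V.projectionOntoL h hc (Ψ x), (IsSmoothGerm.of_clm _).comp hΨ,
    (V.projectionOntoL h hc).hasFDerivAt.comp 0 hderiv,
    hmem.mono fun x hx => hx.trans (Submodule.projectionOntoL_apply_eq_zero_iff hc).symm⟩

theorem exists_isSmoothGerm_exp_add_mem_iff [CompleteSpace E] [CompleteSpace V] [CompleteSpace h]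
    {exp : E → E} (hexp : IsSmoothGerm exp)
    (hexp' : HasFDerivAt exp (.id ℝ E) 0) {Q : Set E} (hQ : IsSubmanifoldAtZero Q V)
    (hc : V.IsTopCompl h) : ∃ φ : V → h, IsSmoothGerm φ ∧ HasFDerivAt φ (0 : V →L[ℝ] h) 0 ∧
      ∀ᶠ z in 𝓝 (0 : V × h), exp (z.1 + z.2) ∈ Q ↔ φ z.1 = z.2 := by
  obtain ⟨Θ, hΘ, hΘ', hmem⟩ := hQ.exists_defining_map hc.symm
  let j : V × h →L[ℝ] E := V.subtypeL.coprod h.subtypeL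
  have hpoint : IsSmoothGerm fun z => exp (j z) := hexp.comp (.of_clm j)
  have hpoint' : HasFDerivAt (fun z => exp (j z)) (.id ℝ E ∘L j) 0 :=
    hasFDerivAt_comp_of_eq hexp' j.hasFDerivAt j.map_zero
  have hΦ' := hasFDerivAt_comp_of_eq hΘ' hpoint' hpoint.map_zero
  have hinl : (h.projectionOntoL V hc.symm ∘L .id ℝ E ∘L j) ∘L .inl ℝ V h = 0 := by
    rw [← projectionOntoL_comp_subtypeL_right hc.symm]
    ext; simp [j]
  have hinr : (h.projectionOntoL V hc.symm ∘L .id ℝ E ∘L j) ∘L .inr ℝ V h = .id ℝ h := by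
    rw [← projectionOntoL_comp_subtypeL hc.symm]
    ext; simp [j]
  obtain ⟨φ, hφ, hφ', hzero⟩ := (hΘ.comp hpoint).exists_implicit hΦ'
    (by rw [hinr]; exact ⟨.refl ℝ h, rfl⟩)
  refine ⟨φ, hφ, hφ'.congr_fderiv (by rw [hinl, ContinuousLinearMap.comp_zero, neg_zero]), ?_⟩
  filter_upwards [hpoint.tendsto.eventually hmem, hzero] with z hz hz' using hz.trans hz'

end SectionMap

namespace LoopInGroup

variable {E : Type*} [NormedAddCommGroup E] [NormedSpace ℝ E] [CompleteSpace E]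
  (S : LoopInGroup E) [CompleteSpace S.V] [CompleteSpace S.h]

theorem isTopCompl : S.V.IsTopCompl S.h :=
  Submodule.IsCompl.isTopCompl_of_isClosed S.isCompl
    (completeSpace_coe_iff_isComplete.1 ‹_›).isClosed
    (completeSpace_coe_iff_isComplete.1 ‹_›).isClosed

theorem isSmoothGerm_sectionMap_and_hasFDerivAt :
    IsSmoothGerm (sectionMap S.exp S.Q S.V S.h) ∧
      HasFDerivAt (sectionMap S.exp S.Q S.V S.h) (0 : S.V →L[ℝ] S.h) 0 := by
  obtain ⟨φ, hφ, hφ', hmem⟩ := exists_isSmoothGerm_exp_add_mem_iff S.isExp.isSmoothGerm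
    S.isExp.hasFDerivAt S.isSubmanifold S.isTopCompl
  have hsection : IsSectionMap S.exp S.Q S.V S.h φ :=
    ⟨hφ.map_zero, hφ.contDiffAt.continuousAt,
      ((tendsto_id.prodMk_nhds hφ.tendsto).eventually hmem).mono fun ξ hξ => hξ.2 rfl⟩
  obtain ⟨h0, hcont, hQ⟩ : IsSectionMap S.exp S.Q S.V S.h (sectionMap S.exp S.Q S.V S.h) :=
    Classical.epsilon_spec ⟨φ, hsection⟩
  have hgraph : Tendsto (fun ξ => (ξ, sectionMap S.exp S.Q S.V S.h ξ)) (𝓝 0) (𝓝 0) :=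
    tendsto_id.prodMk_nhds (by simpa only [h0] using hcont.tendsto)
  have heq : sectionMap S.exp S.Q S.V S.h =ᶠ[𝓝 0] φ := by
    filter_upwards [hgraph.eventually hmem, hQ] with ξ hξ hξQ using (hξ.1 hξQ).symm
  exact ⟨hφ.congr heq, hφ'.congr_of_eventuallyEq heq⟩

theorem isSmoothGerm_sectionMap : IsSmoothGerm (sectionMap S.exp S.Q S.V S.h) :=
  S.isSmoothGerm_sectionMap_and_hasFDerivAt.1

theorem isSmoothGerm_log_point :
    IsSmoothGerm fun x : S.V => (x : E) + (sectionMap S.exp S.Q S.V S.h x : E) :=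
  (IsSmoothGerm.of_clm (S.V.subtypeL.coprod S.h.subtypeL)).comp
    ((IsSmoothGerm.of_clm (.id ℝ S.V)).prodMk S.isSmoothGerm_sectionMap)

theorem isSmoothGerm_point : IsSmoothGerm S.point :=
  S.isExp.isSmoothGerm.comp S.isSmoothGerm_log_point

theorem hasFDerivAt_log_point :
    HasFDerivAt (fun x : S.V => (x : E) + (sectionMap S.exp S.Q S.V S.h x : E)) S.V.subtypeL 0 :=
  (S.V.subtypeL.hasFDerivAt.add
    (S.h.subtypeL.hasFDerivAt.comp 0 S.isSmoothGerm_sectionMap_and_hasFDerivAt.2)).congr_fderiv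
      (by simp)

theorem hasFDerivAt_point : HasFDerivAt S.point S.V.subtypeL 0 :=
  hasFDerivAt_comp_of_eq S.isExp.hasFDerivAt S.hasFDerivAt_log_point
    S.isSmoothGerm_log_point.map_zero

theorem fderiv_fderiv_log_point (ξ η : S.V) :
    fderiv ℝ (fderiv ℝ fun x : S.V => (x : E) + (sectionMap S.exp S.Q S.V S.h x : E)) 0 ξ η =
      (2 : ℝ) • S.R ξ η := by
  have hφ := S.isSmoothGerm_sectionMap
  have hD : fderiv ℝ (fun x : S.V => (x : E) + (sectionMap S.exp S.Q S.V S.h x : E)) =ᶠ[𝓝 0]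
      fun x => S.V.subtypeL + S.h.subtypeL ∘L fderiv ℝ (sectionMap S.exp S.Q S.V S.h) x := by
    filter_upwards [hφ.smooth] with x hx
    exact (S.V.subtypeL.hasFDerivAt.add (S.h.subtypeL.hasFDerivAt.comp x
      (hx.differentiableAt (by simp)).hasFDerivAt)).fderiv
  have hDφ := ((contDiffAt_fderiv hφ.contDiffAt).differentiableAt (by simp)).hasFDerivAt
  have hDDφ := ((hasFDerivAt_const S.h.subtypeL (0 : S.V)).clm_comp hDφ).const_add S.V.subtypeL
  rw [hD.fderiv_eq, hDDφ.fderiv]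
  simp [R, sectionR, smul_smul]

theorem sectionSnd_point (ξ η : S.V) :
    sectionSnd S.G S.point S.V.subtypeL ξ η =
      (1 / 2 : ℝ) • S.G.bracketL ξ η + (2 : ℝ) • S.R ξ η := by
  have h0 := S.isSmoothGerm_log_point.map_zero
  have hD2 := fderiv_fderiv_comp (g := S.exp)
    (by rw [h0]; exact S.isExp.isSmoothGerm.contDiffAt) S.isSmoothGerm_log_point.contDiffAt ξ η
  rw [h0, S.hasFDerivAt_log_point.fderiv, S.isExp.hasFDerivAt.fderiv, S.fderiv_fderiv_log_point,
    S.isExp.fderiv_fderiv_zero] at hD2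
  have hpoint : fderiv ℝ (fderiv ℝ S.point) 0 ξ η = _ := hD2
  simp only [sectionSnd, LocalLieGroup.bracketL, sub_apply, hpoint]
  simp
  module

end LoopInGroup

section Coset

variable {E W : Type*} [NormedAddCommGroup E] [NormedSpace ℝ E] [NormedAddCommGroup W]
  [NormedSpace ℝ W]

/-- `π` is the smooth projection on the section `q` parallel to the local subgroup `K`, near the
unit. -/
structure IsSmoothCosetProj (G : LocalLieGroup E) (K : Set E) (q : W → E) (π : E → W) : Prop where
  isSmoothGerm : IsSmoothGerm π
  mem_iff : ∀ᶠ z in 𝓝 (0 : E × W), G.mul (G.inv (q z.2)) z.1 ∈ K ↔ π z.1 = z.2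
  mul_mem : ∀ᶠ p in 𝓝 (0 : E × E), p.1 ∈ K → p.2 ∈ K → G.mul p.1 p.2 ∈ K

/-- The action of the group on the section `q`, identified with the space of cosets by `π`. -/
def cosetAct (G : LocalLieGroup E) (q : W → E) (π : E → W) (p : E × W) : W :=
  π (G.mul p.1 (q p.2))

namespace IsSmoothCosetProj

variable {G : LocalLieGroup E} {K : Set E} {q : W → E} {π : E → W}

theorem eventually_mem (hπ : IsSmoothCosetProj G K q π) :
    ∀ᶠ g in 𝓝 (0 : E), G.mul (G.inv (q (π g))) g ∈ K :=
  ((tendsto_id.prodMk_nhds hπ.isSmoothGerm.tendsto).eventually hπ.mem_iff).mono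
    fun _ hg => hg.2 rfl

theorem zero_mem (hπ : IsSmoothCosetProj G K q π) (hq : IsSmoothGerm q) : (0 : E) ∈ K := by
  simpa only [hπ.isSmoothGerm.map_zero, hq.map_zero, G.inv_zero, G.mul_zero_zero] using
    hπ.eventually_mem.self_of_nhds

theorem apply_section (hπ : IsSmoothCosetProj G K q π) (hq : IsSmoothGerm q) :
    ∀ᶠ x in 𝓝 (0 : W), π (q x) = x := by
  filter_upwards [(hq.tendsto.prodMk_nhds tendsto_id).eventually hπ.mem_iff,
    hq.tendsto.eventually G.inv_mul] with x hmem hinv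
  exact hmem.1 (hinv.symm ▸ hπ.zero_mem hq)

theorem apply_mul_of_mem (hπ : IsSmoothCosetProj G K q π) (hq : IsSmoothGerm q) :
    ∀ᶠ p in 𝓝 (0 : E × E), p.2 ∈ K → π (G.mul p.1 p.2) = π p.1 := by
  have hg := continuous_fst.tendsto' (0 : E × E) 0 rfl
  have hk := continuous_snd.tendsto' (0 : E × E) 0 rfl
  have hπg := hπ.isSmoothGerm.tendsto.comp hg
  have hinv := G.tendsto_inv (hq.tendsto.comp hπg)
  filter_upwards [hg.eventually hπ.eventually_mem, G.eventually_mul_assoc hinv hg hk,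
    ((G.tendsto_mul hinv hg).prodMk_nhds hk).eventually hπ.mul_mem,
    ((G.tendsto_mul hg hk).prodMk_nhds hπg).eventually hπ.mem_iff]
    with p hmem hassoc hmul hiff hp
  exact hiff.1 (hassoc ▸ hmul hmem hp)

/-- With `x = v⁻¹ g` one has `g u = v u (u⁻¹ x u)`. -/
theorem apply_mul_of_mem_conjSubgroup (hπ : IsSmoothCosetProj G K q π) (hq : IsSmoothGerm q) :
    ∀ᶠ z in 𝓝 (0 : E × E × E), G.mul (G.inv z.2.1) z.1 ∈ G.conjSubgroup K z.2.2 →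
      π (G.mul z.1 z.2.2) = π (G.mul z.2.1 z.2.2) := by
  have hg := continuous_fst.tendsto' (0 : E × E × E) 0 rfl
  have hv : Tendsto (fun z : E × E × E => z.2.1) (𝓝 0) (𝓝 0) :=
    (continuous_fst.comp continuous_snd).tendsto' _ _ rfl
  have hu : Tendsto (fun z : E × E × E => z.2.2) (𝓝 0) (𝓝 0) :=
    (continuous_snd.comp continuous_snd).tendsto' _ _ rfl
  have hx := G.tendsto_mul (G.tendsto_inv hv) hg
  have hux := G.tendsto_mul (G.tendsto_inv hu) hx
  have hk := G.tendsto_mul hux hu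
  filter_upwards [((G.tendsto_mul hv hu).prodMk_nhds hk).eventually (hπ.apply_mul_of_mem hq),
    G.eventually_mul_assoc hv hu hk, G.eventually_mul_assoc hu hux hu,
    G.eventually_mul_inv_cancel_left hu hx, G.eventually_mul_assoc hv hx hu,
    G.eventually_mul_inv_cancel_left hv hg]
    with z hconst hvuk huxu hcancel_u hvxu hcancel_v hmem
  rw [← hconst hmem, hvuk, ← huxu, hcancel_u, ← hvxu, hcancel_v]

theorem isLocalAction (hπ : IsSmoothCosetProj G K q π) (hq : IsSmoothGerm q) :
    G.IsLocalAction (cosetAct G q π) where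
  smooth := (hπ.isSmoothGerm.comp <| G.isSmoothGerm_mul.comp <|
    (IsSmoothGerm.of_clm (.fst ℝ E W)).prodMk (hq.comp (.of_clm (.snd ℝ E W)))).smooth
  zero_act := by
    filter_upwards [hπ.apply_section hq, hq.tendsto.eventually G.one_mul] with y hy hone
    rw [cosetAct, hone, hy]
  mul_act := by
    have ha := continuous_fst.tendsto' (0 : E × E × W) 0 rfl
    have hb := (continuous_fst.comp continuous_snd).tendsto' (0 : E × E × W) 0 rfl
    have hy := hq.tendsto.comp <|
      (continuous_snd.comp continuous_snd).tendsto' (0 : E × E × W) 0 rfl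
    have hc := G.tendsto_mul hb hy
    have hv := hq.tendsto.comp (hπ.isSmoothGerm.tendsto.comp hc)
    have hk := G.tendsto_mul (G.tendsto_inv hv) hc
    filter_upwards [G.eventually_mul_assoc ha hb hy, G.eventually_mul_assoc ha hv hk,
      G.eventually_mul_inv_cancel_left hv hc, hc.eventually hπ.eventually_mem,
      ((G.tendsto_mul ha hv).prodMk_nhds hk).eventually (hπ.apply_mul_of_mem hq)]
      with z hassoc hassoc' hcancel hmem hconst
    simp only [Function.comp_apply] at hassoc hassoc' hcancel hconst
    rw [cosetAct, hassoc, ← hcancel, ← hassoc', hconst hmem]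
    rfl

theorem actField_cosetAct_zero (hπ : IsSmoothCosetProj G K q π) (hq : IsSmoothGerm q) :
    actField (cosetAct G q π) 0 = fderiv ℝ π 0 := by
  have hact := (hπ.isLocalAction hq).isSmoothGerm.contDiffAt.differentiableAt (by simp)
  refine (fderiv_prodMk_left hact).symm.trans (EventuallyEq.fderiv_eq ?_)
  filter_upwards [G.mul_one] with g hg
  rw [cosetAct, Prod.snd_zero, hq.map_zero, hg]

theorem isActSection (hπ : IsSmoothCosetProj G K q π) (hq : IsSmoothGerm q) {ι : W →L[ℝ] E}
    (hq' : HasFDerivAt q ι 0) : IsActSection (cosetAct G q π) q ι := by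
  refine ⟨hq, hq', (hπ.actField_cosetAct_zero hq).symm ▸ ?_⟩
  exact (hasFDerivAt_comp_of_eq hπ.isSmoothGerm.hasFDerivAt hq' hq.map_zero).unique
    ((hasFDerivAt_id 0).congr_of_eventuallyEq (hπ.apply_section hq))

theorem actProj_cosetAct_zero (hπ : IsSmoothCosetProj G K q π) (hq : IsSmoothGerm q)
    {ι : W →L[ℝ] E} (hq' : HasFDerivAt q ι 0) :
    actProj (cosetAct G q π) ι 0 = fderiv ℝ π 0 := by
  rw [actProj, (hπ.isActSection hq hq').actField_comp, hπ.actField_cosetAct_zero hq,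
    ContinuousLinearMap.inverse_id, ContinuousLinearMap.id_comp]

theorem congr (hπ : IsSmoothCosetProj G K q π) {π' : E → W} (h : π' =ᶠ[𝓝 0] π) :
    IsSmoothCosetProj G K q π' where
  isSmoothGerm := hπ.isSmoothGerm.congr h
  mem_iff := by
    filter_upwards [hπ.mem_iff, (continuous_fst.tendsto' (0 : E × W) 0 rfl).eventually h]
      with z hz hz'
    rw [hz, hz']
  mul_mem := hπ.mul_mem

end IsSmoothCosetProj

theorem IsSmoothCosetProj.cosetProj_eventuallyEq {G : LocalLieGroup E} {K : Set E}
    {V : Submodule ℝ E} {q : V → E} {π : E → V} (hπ : IsSmoothCosetProj G K q π) :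
    cosetProj G K q =ᶠ[𝓝 0] π := by
  obtain ⟨h0, hcont, hmem⟩ : IsCosetProj G K q (cosetProj G K q) := Classical.epsilon_spec
    ⟨π, hπ.isSmoothGerm.map_zero, hπ.isSmoothGerm.contDiffAt.continuousAt, hπ.eventually_mem⟩
  have hgraph : Tendsto (fun g => (g, cosetProj G K q g)) (𝓝 0) (𝓝 0) :=
    tendsto_id.prodMk_nhds (by simpa only [h0] using hcont.tendsto)
  filter_upwards [hmem, hgraph.eventually hπ.mem_iff] with g hg hiff using (hiff.1 hg).symm

end Coset

section ConjSubgroup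

variable {E : Type*} [NormedAddCommGroup E] [NormedSpace ℝ E] (G : LocalLieGroup E) {H : Set E}
  {V h : Submodule ℝ E}

theorem IsSubmanifoldAtZero.zero_mem (hH : IsSubmanifoldAtZero H h) : (0 : E) ∈ H := by
  obtain ⟨Ψ, -, hΨ0, -, hmem⟩ := hH
  exact hmem.self_of_nhds.2 (hΨ0.symm ▸ h.zero_mem)

namespace LocalLieGroup

theorem eventually_mem_conjSubgroup_zero : ∀ᶠ x in 𝓝 (0 : E), x ∈ G.conjSubgroup H 0 ↔ x ∈ H := by
  filter_upwards [G.one_mul, G.mul_one] with x hone hone'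
  simp only [conjSubgroup, Set.mem_ofPred_eq, G.inv_zero, hone, hone']

theorem eventually_zero_mem_conjSubgroup (h0 : (0 : E) ∈ H) :
    ∀ᶠ u in 𝓝 (0 : E), (0 : E) ∈ G.conjSubgroup H u := by
  filter_upwards [(G.tendsto_inv tendsto_id).eventually G.mul_one, G.inv_mul] with u hone hinv
  rw [id_eq] at hone
  rwa [conjSubgroup, Set.mem_ofPred_eq, hone, hinv]

theorem eventually_mul_mem_conjSubgroup
    (hH : ∀ᶠ p in 𝓝 (0 : E × E), p.1 ∈ H → p.2 ∈ H → G.mul p.1 p.2 ∈ H) :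
    ∀ᶠ z in 𝓝 (0 : E × E × E), z.2.1 ∈ G.conjSubgroup H z.1 → z.2.2 ∈ G.conjSubgroup H z.1 →
      G.mul z.2.1 z.2.2 ∈ G.conjSubgroup H z.1 := by
  have hu := continuous_fst.tendsto' (0 : E × E × E) 0 rfl
  have hx : Tendsto (fun z : E × E × E => z.2.1) (𝓝 0) (𝓝 0) :=
    (continuous_fst.comp continuous_snd).tendsto' _ _ rfl
  have hy : Tendsto (fun z : E × E × E => z.2.2) (𝓝 0) (𝓝 0) :=
    (continuous_snd.comp continuous_snd).tendsto' _ _ rfl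
  have hinv := G.tendsto_inv hu
  have hux := G.tendsto_mul hinv hx
  have huy := G.tendsto_mul hinv hy
  have hyu := G.tendsto_mul hy hu
  have hk := G.tendsto_mul huy hu
  filter_upwards [((G.tendsto_mul hux hu).prodMk_nhds hk).eventually hH,
    G.eventually_mul_assoc hux hu hk, G.eventually_mul_assoc hinv hy hu,
    G.eventually_mul_inv_cancel_left hu hyu, G.eventually_mul_assoc hux hy hu,
    G.eventually_mul_assoc hinv hx hy] with z hmul huk hyu' hcancel hxyu hxy hmem hmem'
  have hprod := hmul hmem hmem'
  rwa [huk, hyu', hcancel, ← hxyu, hxy] at hprod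

theorem isSmoothGerm_conj_inv_mul {W : Type*} [NormedAddCommGroup W] [NormedSpace ℝ W]
    {q : W → E} (hq : IsSmoothGerm q) : IsSmoothGerm fun z : (E × E) × W =>
      G.mul (G.mul (G.inv z.1.2) (G.mul (G.inv (q z.2)) z.1.1)) z.1.2 := by
  have hg := IsSmoothGerm.of_clm (.fst ℝ E E ∘L .fst ℝ (E × E) W)
  have hu := IsSmoothGerm.of_clm (.snd ℝ E E ∘L .fst ℝ (E × E) W)
  have hv := hq.comp (.of_clm (.snd ℝ (E × E) W))
  have hvg := G.isSmoothGerm_mul.comp ((G.isSmoothGerm_inv.comp hv).prodMk hg)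
  exact G.isSmoothGerm_mul.comp
    ((G.isSmoothGerm_mul.comp ((G.isSmoothGerm_inv.comp hu).prodMk hvg)).prodMk hu)

theorem hasFDerivAt_conj_inv_mul {W : Type*} [NormedAddCommGroup W] [NormedSpace ℝ W]
    {q : W → E} {ι : W →L[ℝ] E} (hq : IsSmoothGerm q) (hq' : HasFDerivAt q ι 0) :
    HasFDerivAt (fun z : (E × E) × W =>
      G.mul (G.mul (G.inv z.1.2) (G.mul (G.inv (q z.2)) z.1.1)) z.1.2)
      (.fst ℝ E E ∘L .fst ℝ (E × E) W - ι ∘L .snd ℝ (E × E) W) 0 := by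
  have hg : HasFDerivAt (fun z : (E × E) × W => z.1.1) _ 0 :=
    (.fst ℝ E E ∘L .fst ℝ (E × E) W : (E × E) × W →L[ℝ] E).hasFDerivAt
  have hu : HasFDerivAt (fun z : (E × E) × W => z.1.2) _ 0 :=
    (.snd ℝ E E ∘L .fst ℝ (E × E) W : (E × E) × W →L[ℝ] E).hasFDerivAt
  have hv : HasFDerivAt (fun z : (E × E) × W => q z.2) _ 0 :=
    hasFDerivAt_comp_of_eq hq' (.snd ℝ (E × E) W : _ →L[ℝ] W).hasFDerivAt rfl
  have hvinv := hasFDerivAt_comp_of_eq G.hasFDerivAt_inv hv hq.map_zero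
  have huinv := hasFDerivAt_comp_of_eq G.hasFDerivAt_inv hu rfl
  have hvg := hasFDerivAt_comp_of_eq G.hasFDerivAt_mul (hvinv.prodMk hg)
    (by simp [hq.map_zero, G.inv_zero])
  have huvg := hasFDerivAt_comp_of_eq G.hasFDerivAt_mul (huinv.prodMk hvg)
    (by simp [hq.map_zero, G.inv_zero, G.mul_zero_zero])
  have hκ := hasFDerivAt_comp_of_eq G.hasFDerivAt_mul (huvg.prodMk hu)
    (by simp [hq.map_zero, G.inv_zero, G.mul_zero_zero])
  refine hκ.congr_fderiv (ContinuousLinearMap.ext fun z => ?_)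
  simp
  abel

end LocalLieGroup

/-- `g ↦ Λ (g, u)` is the projection on the section `q` parallel to `u K u⁻¹`, jointly smooth in
`g` and `u` near the unit. -/
structure IsSmoothConjProj {W : Type*} [NormedAddCommGroup W] [NormedSpace ℝ W]
    (G : LocalLieGroup E) (K : Set E) (q : W → E) (Λ : E × E → W) : Prop where
  isSmoothGerm : IsSmoothGerm Λ
  mem_iff : ∀ᶠ z in 𝓝 (0 : (E × E) × W),
    G.mul (G.inv (q z.2)) z.1.1 ∈ G.conjSubgroup K z.1.2 ↔ Λ z.1 = z.2

theorem IsSubmanifoldAtZero.exists_isSmoothConjProj [CompleteSpace E] [CompleteSpace V]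
    (hH : IsSubmanifoldAtZero H h) (hc : V.IsTopCompl h) {q : V → E} (hq : IsSmoothGerm q)
    (hq' : HasFDerivAt q V.subtypeL 0) : ∃ Λ : E × E → V, IsSmoothConjProj G H q Λ ∧
      HasFDerivAt Λ (V.projectionOntoL h hc ∘L .fst ℝ E E) 0 := by
  obtain ⟨Θ, hΘ, hΘ', hmem⟩ := hH.exists_defining_map hc
  have hκ := G.isSmoothGerm_conj_inv_mul hq
  have hΦ' := hasFDerivAt_comp_of_eq hΘ' (G.hasFDerivAt_conj_inv_mul hq hq') hκ.map_zero
  have hinl : (V.projectionOntoL h hc ∘L (.fst ℝ E E ∘L .fst ℝ (E × E) V -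
      V.subtypeL ∘L .snd ℝ (E × E) V)) ∘L .inl ℝ (E × E) V =
      V.projectionOntoL h hc ∘L .fst ℝ E E := by
    ext <;> simp
  have hinr : (V.projectionOntoL h hc ∘L (.fst ℝ E E ∘L .fst ℝ (E × E) V -
      V.subtypeL ∘L .snd ℝ (E × E) V)) ∘L .inr ℝ (E × E) V =
      (ContinuousLinearEquiv.neg ℝ : V ≃L[ℝ] V) := by
    ext; simp
  obtain ⟨Λ, hΛ, hΛ', hzero⟩ := (hΘ.comp hκ).exists_implicit hΦ'
    (hinr ▸ ⟨.neg ℝ, rfl⟩)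
  refine ⟨Λ, ⟨hΛ, ?_⟩, hΛ'.congr_fderiv ?_⟩
  · filter_upwards [hκ.tendsto.eventually hmem, hzero] with z hz hz' using hz.trans hz'
  · rw [hinl, hinr, ContinuousLinearMap.inverse_equiv]
    ext <;> simp

end ConjSubgroup

section ConjProj

variable {E W : Type*} [NormedAddCommGroup E] [NormedSpace ℝ E] [NormedAddCommGroup W]
  [NormedSpace ℝ W] {G : LocalLieGroup E} {H : Set E}

/-- The derivative at the unit of `g ↦ Λ (g, u)`: the projection of the Lie algebra parallel to the
Lie algebra of `u H u⁻¹`, when `Λ` is the projection parallel to the conjugates of `H`. -/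
def conjProjDeriv (Λ : E × E → W) (u : E) : E →L[ℝ] W := fderiv ℝ Λ (0, u) ∘L .inl ℝ E E

theorem differentiableAt_conjProjDeriv {Λ : E × E → W} (hΛ : IsSmoothGerm Λ) :
    DifferentiableAt ℝ (conjProjDeriv Λ) 0 :=
  (((contDiffAt_fderiv hΛ.contDiffAt).differentiableAt (by simp)).comp 0
    ((differentiableAt_const (0 : E)).prodMk differentiableAt_id)).clm_comp
    (differentiableAt_const _)

namespace IsSmoothConjProj

variable {q : W → E} {Λ : E × E → W} {π : E → W} {ι : W →L[ℝ] E}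

theorem eventually_apply_zero_left (hΛ : IsSmoothConjProj G H q Λ) (hq : IsSmoothGerm q)
    (h0 : (0 : E) ∈ H) : ∀ᶠ u in 𝓝 (0 : E), Λ (0, u) = 0 := by
  have hin := (IsSmoothGerm.of_clm (.inl ℝ (E × E) W ∘L .inr ℝ E E)).tendsto
  filter_upwards [hin.eventually hΛ.mem_iff, G.eventually_zero_mem_conjSubgroup h0] with u hu hmem
  refine hu.1 ?_
  simpa [hq.map_zero, G.inv_zero, G.mul_zero_zero] using hmem

theorem eventually_isSmoothCosetProj (hΛ : IsSmoothConjProj G H q Λ) (hq : IsSmoothGerm q)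
    (h0 : (0 : E) ∈ H)
    (hmul : ∀ᶠ p in 𝓝 (0 : E × E), p.1 ∈ H → p.2 ∈ H → G.mul p.1 p.2 ∈ H) :
    ∀ᶠ u in 𝓝 (0 : E),
      IsSmoothCosetProj G (G.conjSubgroup H u) q fun g => Λ (g, u) := by
  have hswap : Tendsto (fun z : E × E => (z.2, z.1)) (𝓝 (0, 0)) (𝓝 0) :=
    continuous_swap.tendsto' _ _ rfl
  have hrot : Tendsto (fun z : E × E × W => ((z.2.1, z.1), z.2.2)) (𝓝 (0, 0)) (𝓝 0) :=
    (show Continuous fun z : E × E × W => ((z.2.1, z.1), z.2.2) by fun_prop).tendsto' _ _ rfl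
  filter_upwards [(hswap.eventually hΛ.isSmoothGerm.smooth).curry_nhds,
    (hrot.eventually hΛ.mem_iff).curry_nhds, hΛ.eventually_apply_zero_left hq h0,
    (Prod.mk_zero_zero (M := E) (N := E × E) ▸
      G.eventually_mul_mem_conjSubgroup hmul).curry_nhds] with u hsmooth hiff hzero hmul'
  exact ⟨⟨hsmooth.mono fun g hg => hg.comp g (contDiffAt_id.prodMk contDiffAt_const), hzero⟩,
    hiff, hmul'⟩

theorem isSmoothCosetProj (hΛ : IsSmoothConjProj G H q Λ) (hq : IsSmoothGerm q)
    (hmul : ∀ᶠ p in 𝓝 (0 : E × E), p.1 ∈ H → p.2 ∈ H → G.mul p.1 p.2 ∈ H) :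
    IsSmoothCosetProj G H q fun g => Λ (g, 0) where
  isSmoothGerm := hΛ.isSmoothGerm.comp (.of_clm (.inl ℝ E E))
  mem_iff := by
    have hin := (IsSmoothGerm.of_clm ((ContinuousLinearMap.inl ℝ E E).prodMap (.id ℝ W))).tendsto
    have hquot := G.tendsto_mul
      (G.tendsto_inv (hq.tendsto.comp (continuous_snd.tendsto' (0 : E × W) 0 rfl)))
      (continuous_fst.tendsto' (0 : E × W) 0 rfl)
    filter_upwards [hin.eventually hΛ.mem_iff, hquot.eventually G.eventually_mem_conjSubgroup_zero]
      with z hz hmem using hmem.symm.trans hz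
  mul_mem := hmul

theorem eventually_cosetAct_section (hΛ : IsSmoothConjProj G H q Λ)
    (hπ : IsSmoothCosetProj G H q π) (hq : IsSmoothGerm q) :
    ∀ᶠ z in 𝓝 ((0, 0) : W × E),
      cosetAct G q π (z.2, z.1) = cosetAct G q π (q (Λ (z.2, q z.1)), z.1) := by
  have hfst : Tendsto (fun z : W × E => q z.1) (𝓝 (0, 0)) (𝓝 0) :=
    hq.tendsto.comp (continuous_fst.tendsto' (0 : W × E) 0 rfl)
  have hsnd : Tendsto (fun z : W × E => z.2) (𝓝 (0, 0)) (𝓝 0) :=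
    continuous_snd.tendsto' (0 : W × E) 0 rfl
  have hΛgy := hΛ.isSmoothGerm.tendsto.comp (hsnd.prodMk_nhds hfst)
  filter_upwards [((hsnd.prodMk_nhds hfst).prodMk_nhds hΛgy).eventually hΛ.mem_iff,
    (hsnd.prodMk_nhds ((hq.tendsto.comp hΛgy).prodMk_nhds hfst)).eventually
      (hπ.apply_mul_of_mem_conjSubgroup hq)] with z hmem htranslate
  exact htranslate (hmem.2 rfl)

/-- The isotropy algebra at the point `y` is the Lie algebra of `q(y) H q(y)⁻¹`. -/
theorem eventually_actProj_cosetAct [CompleteSpace W] (hΛ : IsSmoothConjProj G H q Λ)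
    (hπ : IsSmoothCosetProj G H q π) (hq : IsSmoothGerm q) (hq' : HasFDerivAt q ι 0) :
    ∀ᶠ y in 𝓝 (0 : W), actProj (cosetAct G q π) ι y = conjProjDeriv Λ (q y) := by
  have hact := hπ.isLocalAction hq
  have hsmooth := (IsSmoothGerm.of_clm (.inr ℝ E E)).tendsto.eventually hΛ.isSmoothGerm.smooth
  filter_upwards [(hΛ.eventually_cosetAct_section hπ hq).curry_nhds,
    hact.smooth_zero, hq.tendsto.eventually hsmooth,
    hq.tendsto.eventually (hΛ.eventually_apply_zero_left hq (hπ.zero_mem hq)),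
    hact.eventually_isInvertible_actField (hπ.isActSection hq hq')] with y hy hρy hΛy hzero hinv
  have hρ := hρy.differentiableAt (by simp)
  have hslice : HasFDerivAt (fun g => cosetAct G q π (g, y)) (actField (cosetAct G q π) y) 0 :=
    hρ.hasFDerivAt.comp (f := fun g => (g, y)) 0 (hasFDerivAt_prodMk_left 0 y)
  have hΛ' : HasFDerivAt (fun g => Λ (g, q y)) (conjProjDeriv Λ (q y)) 0 :=
    (hΛy.differentiableAt (by simp)).hasFDerivAt.comp (f := fun g => (g, q y)) 0
      (hasFDerivAt_prodMk_left 0 (q y))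
  have hqΛ : HasFDerivAt (fun g => q (Λ (g, q y))) (ι ∘L conjProjDeriv Λ (q y)) 0 :=
    hasFDerivAt_comp_of_eq hq' hΛ' hzero
  have hcomp : actField (cosetAct G q π) y =
      (actField (cosetAct G q π) y ∘L ι) ∘L conjProjDeriv Λ (q y) :=
    (hslice.congr_of_eventuallyEq (hy.mono fun _ h => h.symm)).unique
      (hasFDerivAt_comp_of_eq hslice hqΛ (by rw [hzero, hq.map_zero]))
  rw [actProj]
  nth_rw 2 [hcomp]
  exact ContinuousLinearMap.ext fun v => hinv.inverse_apply_self _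

end IsSmoothConjProj

end ConjProj

section LoopLaw

variable {E : Type*} [NormedAddCommGroup E] [NormedSpace ℝ E]

theorem LocalLieGroup.IsLocalAction.webNablaTwoB_actLaw_zero_eq_bracketL {W : Type*}
    [NormedAddCommGroup W] [NormedSpace ℝ W] [CompleteSpace W] {G : LocalLieGroup E}
    {ρ : E × W → W} {q : W → E} {ι : W →L[ℝ] E}
    (hρ : G.IsLocalAction ρ) (hq : IsActSection ρ q ι) (ξ η ζ τ : W) {v : E}
    (hv : v = sectionSnd G q ι ξ η - ι (actProj ρ ι 0 (sectionSnd G q ι ξ η))) :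
    webNablaTwoB (actLaw ρ q) 0 ξ η ζ τ =
      actProj ρ ι 0 (G.bracketL (ι (actProj ρ ι 0 (G.bracketL v (ι τ)))) (ι ζ))
        - actProj ρ ι 0 (G.bracketL
          (G.bracketL v (ι ζ) - ι (actProj ρ ι 0 (G.bracketL v (ι ζ)))) (ι τ)) := by
  have hproj := ((hρ.contDiffAt_actProj hq).self_of_nhds.differentiableAt (by simp)).hasFDerivAt
  have hfield : actField ρ 0 (ι τ) = τ := DFunLike.congr_fun hq.actField_comp τ
  have hproj' := (hρ.fderiv_actProj hq).self_of_nhds τ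
  rw [hfield] at hproj'
  obtain ⟨C', hC, hC'⟩ := hasFDerivAt_projCurv G q ι hproj ξ η ζ
  rw [hρ.webNablaTwoB_actLaw_zero hq, hC.fderiv, hC', hproj', hproj', ← hv]

namespace IsSmoothCosetProj

variable {G : LocalLieGroup E} {K : Set E} {V : Submodule ℝ E} {q : V → E} {π : E → V}
  {ι : V →L[ℝ] E}

theorem isSmoothCosetProj_cosetProj (hπ : IsSmoothCosetProj G K q π) :
    IsSmoothCosetProj G K q (cosetProj G K q) :=
  hπ.congr hπ.cosetProj_eventuallyEq

theorem webB_loopLaw_zero [CompleteSpace V] (hπ : IsSmoothCosetProj G K q π)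
    (hq : IsSmoothGerm q) (hq' : HasFDerivAt q ι 0) (ξ η ζ : V) :
    webB (loopLaw G K q) 0 ξ η ζ = projCurv G q ι (fderiv ℝ π 0) ξ η ζ := by
  have hK := hπ.isSmoothCosetProj_cosetProj
  rw [← hπ.cosetProj_eventuallyEq.fderiv_eq, ← hK.actProj_cosetAct_zero hq hq']
  exact (hK.isLocalAction hq).webB_actLaw_zero (hK.isActSection hq hq') ξ η ζ

end IsSmoothCosetProj

/-- Both sides differentiate the same function of the projection: the curvature at `(0, y)` is that
of the loop at the unit obtained from the conjugate of `H` by `q y`. -/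
theorem IsSmoothConjProj.exists_hasFDerivAt_webB_loopLaw_conjSubgroup {G : LocalLieGroup E}
    {H : Set E} {V : Submodule ℝ E} [CompleteSpace V] {q : V → E} {Λ : E × E → V} {ι : V →L[ℝ] E}
    (hΛ : IsSmoothConjProj G H q Λ) (hq : IsSmoothGerm q) (hq' : HasFDerivAt q ι 0)
    (h0 : (0 : E) ∈ H)
    (hmul : ∀ᶠ p in 𝓝 (0 : E × E), p.1 ∈ H → p.2 ∈ H → G.mul p.1 p.2 ∈ H) (ξ η ζ : V) :
    ∃ C' : E →L[ℝ] V,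
      HasFDerivAt (fun u => webB (loopLaw G (G.conjSubgroup H u) q) 0 ξ η ζ) C' 0 ∧
      ∀ τ, webNablaTwoB (loopLaw G H q) 0 ξ η ζ τ = C' (ι τ) := by
  have hH := (hΛ.isSmoothCosetProj hq hmul).isSmoothCosetProj_cosetProj
  obtain ⟨C', hC, -⟩ := hasFDerivAt_projCurv G q ι
    (differentiableAt_conjProjDeriv hΛ.isSmoothGerm).hasFDerivAt ξ η ζ
  refine ⟨C', hC.congr_of_eventuallyEq ?_, fun τ => ?_⟩
  · filter_upwards [hΛ.eventually_isSmoothCosetProj hq h0 hmul,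
      (IsSmoothGerm.of_clm (.inr ℝ E E)).tendsto.eventually hΛ.isSmoothGerm.smooth] with u hu hΛu
    rw [hu.webB_loopLaw_zero hq hq', conjProjDeriv]
    exact congrArg (fun L => projCurv G q ι L ξ η ζ)
      (fderiv_prodMk_left (p := (0, u)) (hΛu.differentiableAt (by simp)))
  · have hcurv : (fun y => projCurv G q ι
        (actProj (cosetAct G q (cosetProj G H q)) ι y) ξ η ζ) =ᶠ[𝓝 0] fun y =>
        projCurv G q ι (conjProjDeriv Λ (q y)) ξ η ζ :=
      (hΛ.eventually_actProj_cosetAct hH hq hq').mono fun y hy =>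
        congrArg (fun L => projCurv G q ι L ξ η ζ) hy
    have hchain := hasFDerivAt_comp_of_eq hC hq' hq.map_zero
    have hd := (hH.isLocalAction hq).webNablaTwoB_actLaw_zero (hH.isActSection hq hq') ξ η ζ τ
    rw [hcurv.fderiv_eq, hchain.fderiv] at hd
    exact hd

end LoopLaw

namespace LoopInGroup

variable {E : Type*} [NormedAddCommGroup E] [NormedSpace ℝ E] (S : LoopInGroup E)

/-- The action of the local group on `Q`, seen as the space of left cosets of `H`. -/
def act : E × S.V → S.V := cosetAct S.G S.point (cosetProj S.G S.H S.point)

theorem law_eq_actLaw : S.law = actLaw S.act S.point := rfl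

variable [CompleteSpace E] [CompleteSpace S.V] [CompleteSpace S.h]

theorem exists_isSmoothConjProj : ∃ Λ : E × E → S.V, IsSmoothConjProj S.G S.H S.point Λ ∧
    HasFDerivAt Λ (S.V.projectionOntoL S.h S.isTopCompl ∘L .fst ℝ E E) 0 :=
  S.isLocalSubgroup.1.exists_isSmoothConjProj S.G S.isTopCompl S.isSmoothGerm_point
    S.hasFDerivAt_point

theorem isSmoothCosetProj : IsSmoothCosetProj S.G S.H S.point (cosetProj S.G S.H S.point) := by
  obtain ⟨Λ, hΛ, -⟩ := S.exists_isSmoothConjProj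
  exact (hΛ.isSmoothCosetProj S.isSmoothGerm_point
    S.isLocalSubgroup.2.1).isSmoothCosetProj_cosetProj

theorem isLocalAction_act : S.G.IsLocalAction S.act :=
  S.isSmoothCosetProj.isLocalAction S.isSmoothGerm_point

theorem isActSection_point : IsActSection S.act S.point S.V.subtypeL :=
  S.isSmoothCosetProj.isActSection S.isSmoothGerm_point S.hasFDerivAt_point

theorem actProj_act_zero :
    actProj S.act S.V.subtypeL 0 = S.V.projectionOntoL S.h S.isTopCompl := by
  obtain ⟨Λ, hΛ, hΛ'⟩ := S.exists_isSmoothConjProj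
  have hπ := hΛ.isSmoothCosetProj S.isSmoothGerm_point S.isLocalSubgroup.2.1
  rw [act, S.isSmoothCosetProj.actProj_cosetAct_zero S.isSmoothGerm_point S.hasFDerivAt_point,
    hπ.cosetProj_eventuallyEq.fderiv_eq]
  exact (hΛ'.comp (0 : E) (f := fun g => (g, 0)) (hasFDerivAt_prodMk_left 0 0)).fderiv

theorem hasDerivAt_bConj (ξ η ζ τ : S.V) :
    HasDerivAt (fun t : ℝ => S.bConj (S.exp (t • (τ : E))) ξ η ζ) (S.d ξ η ζ τ) 0 := by
  obtain ⟨Λ, hΛ, -⟩ := S.exists_isSmoothConjProj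
  obtain ⟨C', hC, hd⟩ := hΛ.exists_hasFDerivAt_webB_loopLaw_conjSubgroup S.isSmoothGerm_point
    S.hasFDerivAt_point S.isLocalSubgroup.1.zero_mem S.isLocalSubgroup.2.1 ξ η ζ
  have hline := (ContinuousLinearMap.toSpanSingleton ℝ (τ : E)).hasFDerivAt (x := 0)
  have hexp := hasFDerivAt_comp_of_eq S.isExp.hasFDerivAt hline (zero_smul ℝ (τ : E))
  have hcurv := hasFDerivAt_comp_of_eq hC hexp (by simp [S.isExp.isSmoothGerm.map_zero])
  refine hcurv.hasDerivAt.congr_deriv ?_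
  simpa [d, law] using (hd τ).symm

theorem d_formula (ξ η ζ τ : S.V) :
    (S.d ξ η ζ τ : E) =
        (1 / 2 : ℝ) • S.Pr (S.br τ (S.br (S.br ξ η) ζ))
        - (1 / 2 : ℝ) • S.Pr (S.br τ (S.Pr (S.br (S.br ξ η) ζ)))
        - (1 / 2 : ℝ) • S.Pr (S.br τ (S.br (S.Pr (S.br ξ η)) ζ))
        + (1 / 2 : ℝ) • S.Pr (S.br τ (S.Pr (S.br (S.Pr (S.br ξ η)) ζ)))
        - (1 / 2 : ℝ) • S.Pr (S.br (S.Pr (S.br τ (S.br ξ η))) ζ)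
        + (1 / 2 : ℝ) • S.Pr (S.br (S.Pr (S.br τ (S.Pr (S.br ξ η)))) ζ)
        + (2 : ℝ) • S.Pr (S.br τ (S.br (S.R ξ η) ζ))
        - (2 : ℝ) • S.Pr (S.br τ (S.Pr (S.br (S.R ξ η) ζ)))
        - (2 : ℝ) • S.Pr (S.br (S.Pr (S.br τ (S.R ξ η))) ζ) := by
  have hbr (x y : E) : S.br x y = S.G.bracketL x y := (S.G.bracketL_apply x y).symm
  have hPr (x : E) : S.Pr x = S.V.projectionOntoL S.h S.isTopCompl x := rfl
  have hPrR : S.V.projectionOntoL S.h S.isTopCompl (S.R ξ η) = 0 :=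
    (Submodule.projectionOnto_apply_eq_zero_iff S.isCompl).2
      (sectionR S.exp S.Q S.V S.h ξ η).2
  rw [d, law_eq_actLaw, S.isLocalAction_act.webNablaTwoB_actLaw_zero_eq_bracketL
    S.isActSection_point _ _ _ _ rfl, S.actProj_act_zero, S.sectionSnd_point]
  simp only [Submodule.subtypeL_apply]
  rw [S.G.bracketL_swap _ (τ : E), S.G.bracketL_swap _ (τ : E)]
  simp only [hbr, hPr, hPrR, map_add, map_sub, map_smul, map_neg, smul_zero, add_zero,
    add_apply, sub_apply, neg_apply, smul_apply, Submodule.coe_add, Submodule.coe_sub,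
    Submodule.coe_neg, Submodule.coe_smul]
  module

theorem d_alternation (ξ η ζ τ : S.V) :
    (1 / 2 : ℝ) • (S.d ξ η ζ τ - S.d ξ η τ ζ) = -S.b ξ η (S.a ζ τ) :=
  (S.isLocalAction_act.isRegularWebAt_actLaw S.isActSection_point).webNablaTwoB_alternation ξ η ζ τ

end LoopInGroup

end

theorem mainTheorem2_general {E : Type*} [NormedAddCommGroup E] [NormedSpace ℝ E]
    [CompleteSpace E] (S : LoopInGroup E) [CompleteSpace S.V] [CompleteSpace S.h] :
    (∀ᶠ p in 𝓝 (0 : S.V × S.V), ContDiffAt ℝ ∞ S.law p) ∧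
    (∀ ξ η ζ τ : S.V,
      (S.d ξ η ζ τ : E) =
        (1 / 2 : ℝ) • S.Pr (S.br τ (S.br (S.br ξ η) ζ))
        - (1 / 2 : ℝ) • S.Pr (S.br τ (S.Pr (S.br (S.br ξ η) ζ)))
        - (1 / 2 : ℝ) • S.Pr (S.br τ (S.br (S.Pr (S.br ξ η)) ζ))
        + (1 / 2 : ℝ) • S.Pr (S.br τ (S.Pr (S.br (S.Pr (S.br ξ η)) ζ)))
        - (1 / 2 : ℝ) • S.Pr (S.br (S.Pr (S.br τ (S.br ξ η))) ζ)
        + (1 / 2 : ℝ) • S.Pr (S.br (S.Pr (S.br τ (S.Pr (S.br ξ η)))) ζ)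
        + (2 : ℝ) • S.Pr (S.br τ (S.br (S.R ξ η) ζ))
        - (2 : ℝ) • S.Pr (S.br τ (S.Pr (S.br (S.R ξ η) ζ)))
        - (2 : ℝ) • S.Pr (S.br (S.Pr (S.br τ (S.R ξ η))) ζ)) ∧
    (∀ ξ η ζ τ : S.V,
      HasDerivAt (fun t : ℝ => S.bConj (S.exp (t • (τ : E))) ξ η ζ) (S.d ξ η ζ τ) 0) ∧
    (∀ ξ η ζ τ : S.V,
      (1 / 2 : ℝ) • (S.d ξ η ζ τ - S.d ξ η τ ζ) = -S.b ξ η (S.a ζ τ)) :=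
  ⟨S.law_eq_actLaw ▸ (S.isLocalAction_act.isSmoothGerm_actLaw S.isSmoothGerm_point).smooth,
    S.d_formula, S.hasDerivAt_bConj, S.d_alternation⟩

theorem mainTheorem2 {E : Type*} [NormedAddCommGroup E] [NormedSpace ℝ E] [FiniteDimensional ℝ E]
    (S : LoopInGroup E) :
    (∀ᶠ p in 𝓝 (0 : S.V × S.V), ContDiffAt ℝ ∞ S.law p) ∧
    (∀ ξ η ζ τ : S.V,
      (S.d ξ η ζ τ : E) =
        (1 / 2 : ℝ) • S.Pr (S.br τ (S.br (S.br ξ η) ζ))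
        - (1 / 2 : ℝ) • S.Pr (S.br τ (S.Pr (S.br (S.br ξ η) ζ)))
        - (1 / 2 : ℝ) • S.Pr (S.br τ (S.br (S.Pr (S.br ξ η)) ζ))
        + (1 / 2 : ℝ) • S.Pr (S.br τ (S.Pr (S.br (S.Pr (S.br ξ η)) ζ)))
        - (1 / 2 : ℝ) • S.Pr (S.br (S.Pr (S.br τ (S.br ξ η))) ζ)
        + (1 / 2 : ℝ) • S.Pr (S.br (S.Pr (S.br τ (S.Pr (S.br ξ η)))) ζ)
        + (2 : ℝ) • S.Pr (S.br τ (S.br (S.R ξ η) ζ))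
        - (2 : ℝ) • S.Pr (S.br τ (S.Pr (S.br (S.R ξ η) ζ)))
        - (2 : ℝ) • S.Pr (S.br (S.Pr (S.br τ (S.R ξ η))) ζ)) ∧
    (∀ ξ η ζ τ : S.V,
      HasDerivAt (fun t : ℝ => S.bConj (S.exp (t • (τ : E))) ξ η ζ) (S.d ξ η ζ τ) 0) ∧
    (∀ ξ η ζ τ : S.V,
      (1 / 2 : ℝ) • (S.d ξ η ζ τ - S.d ξ η τ ζ) = -S.b ξ η (S.a ζ τ)) :=
  haveI := FiniteDimensional.complete ℝ E
  mainTheorem2_general S
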